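/- Let $Y=(0,\infty)\times\mathbb R$ with elements $y=(m,p)$ and Lebesgue measure $dy = dm\,dp$. Consider the coagulation equation with constant rate $a\equiv 1$, $$\partial_t f = Q_1(f)-Q_2(f)\ \text{ in } (0,\infty)\times Y,\qquad f(0,\cdot)=f_{in},$$ $$Q_1(f)(m,p)=\frac12\int_{\mathbb R}\int_0^m f(m',p')f(m-m',p-p')\,dm'dp',\qquad Q_2(f)(m,p)=f(m,p)\int_{\mathbb R}\int_0^\infty f(m',p')\,dm'dp'.$$ Let $f_{in}\ge 0$ on $Y$ be even in $p$, with $f_{in}\in L^1(Y,(1+m+p^2)\,dy)$ and $\int_Y f_{in}>0$. Put $$H_0=\Big(\int_Y f_{in}\Big)^{-1},\qquad \mathcal A=H_0^2\int_Y m\,f_{in}\,dm\,dp,\qquad \mathcal B=H_0^2\int_Y p^2 f_{in}\,dm\,dp .$$ For $g\in L^1(Y)$, $\operatorname{Re}\zeta\ge0$, $\xi\in\mathbb R$ let $\mathcal{FL}g(\zeta,\xi)=\int_Y e^{-m\zeta}e^{-ip\xi}g(m,p)\,dm\,dp$, and call $g$ the inverse Fourier–Laplace transform of $G$ if $g$ is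 the function in $L^1(Y)$, unique up to null sets, such that $\mathcal{FL}g=G$ on $\{\operatorname{Re}\zeta\ge0\}\times\mathbb R$. Put $F(0,\cdot,\cdot)=\mathcal{FL}f_{in}$ and, for $t\ge 0$, $$F(t,\zeta,\xi)=\frac{H_0^2}{\left(H_0+\frac t2\right)^2\left(\frac1{F(0,\zeta,\xi)}-\frac{H_0t/2}{H_0+t/2}\right)}$$ (read as $0$ where $F(0,\zeta,\xi)=0$). Then: 1. For all $t\ge0$, $\operatorname{Re}\zeta\ge0$, $\xi\in\mathbb R$, the last factor of the denominator is nonzero whenever $F(0,\zeta,\xi)\ne0$, the formula gives back $F(0,\zeta,\xi)$ at $t=0$, $F(t,0,0)=1/(H_0+t/2)$, and $F$ solves the Bernoulli equation $\partial_tF(t,\zeta,\xi)=\frac12F(t,\zeta,\xi)^2-F(t,0,0)F(t,\zeta,\xi)$. 2. There is a nonnegative solution $f\in C([0,\infty);L^1(Y,(1+m+p^2)dy))$ of the equation with $f(0,\cdot)=f_{in}$ on $Y$ (for a.e. $y\in Y$ the equation holds for every $t\ge0$, with one-sided derivative at $t=0$ and both integrals absolutely convergent) such that, for every $t\ge0$,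 $f(t,\cdot)$ is the inverse Fourier–Laplace transform of $F(t,\cdot,\cdot)$. If $f_{in}$ is moreover continuous and bounded on $Y$, then for every $t\ge 0$ the function $f(t,\cdot)$ is continuous on $Y$ and the equation holds at every point $y\in Y$. 3. This $f$ satisfies, as $t\to+\infty$, $$t^{5/2}f(t,tm,\sqrt t\,p)\ \rightharpoonup\ \varphi_\infty(m,p)=\frac{4H_0^2}{\sqrt{2\pi\mathcal A\mathcal B}}\;\frac{e^{-2H_0^2m/\mathcal A}\,e^{-\mathcal A p^2/(2\mathcal B m)}}{\sqrt m}$$ weakly as measures, i.e. $\varphi_\infty\in L^1(Y)$ and, for every $\psi\in C_c(Y)$, $\int_Y\psi(m,p)\,t^{5/2}f(t,tm,\sqrt t\,p)\,dm\,dp\to\int_Y\psi\,\varphi_\infty\,dm\,dp$. -/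

import Mathlib

open MeasureTheory Set Filter Topology

noncomputable section

namespace Coag

/-- The state space `Y = (0, ∞) × ℝ` of pairs `y = (m, p)` (mass, momentum). -/
def Y : Set (ℝ × ℝ) := Ioi (0 : ℝ) ×ˢ (univ : Set ℝ)

/-- The integrand of the gain term at `y = (m, p)`, a function of `y' = (m', p')`. -/
def gainIntegrand (a : ℝ × ℝ → ℝ × ℝ → ℝ) (g : ℝ × ℝ → ℝ) (y y' : ℝ × ℝ) : ℝ :=
  a y' (y - y') * g y' * g (y - y')

/-- The integrand of the loss term at `y = (m, p)`, a function of `y' = (m', p')`. -/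
def lossIntegrand (a : ℝ × ℝ → ℝ × ℝ → ℝ) (g : ℝ × ℝ → ℝ) (y y' : ℝ × ℝ) : ℝ :=
  a y y' * g y * g y'

/-- The gain term `Q₁(g)(y) = (1/2) ∫_ℝ ∫_0^m a(y', y - y') g(y') g(y - y') dm' dp'`. -/
def Q₁ (a : ℝ × ℝ → ℝ × ℝ → ℝ) (g : ℝ × ℝ → ℝ) (y : ℝ × ℝ) : ℝ :=
  (1 / 2) * ∫ y' in Ioo (0 : ℝ) y.1 ×ˢ (univ : Set ℝ), gainIntegrand a g y y'

/-- The loss term `Q₂(g)(y) = ∫_ℝ ∫_0^∞ a(y, y') g(y) g(y') dm' dp'`. -/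
def Q₂ (a : ℝ × ℝ → ℝ × ℝ → ℝ) (g : ℝ × ℝ → ℝ) (y : ℝ × ℝ) : ℝ :=
  ∫ y' in Y, lossIntegrand a g y y'

/-- The equation `∂ₜ f = Q₁(f) - Q₂(f)` holds at time `t ≥ 0` and at the point `y`, both integrals
being absolutely convergent (the derivative is one-sided at `t = 0`). -/
structure SolvesAt (a : ℝ × ℝ → ℝ × ℝ → ℝ) (f : ℝ → ℝ × ℝ → ℝ) (t : ℝ) (y : ℝ × ℝ) : Prop where
  gain_integrable : IntegrableOn (gainIntegrand a (f t) y) (Ioo (0 : ℝ) y.1 ×ˢ (univ : Set ℝ))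
  loss_integrable : IntegrableOn (lossIntegrand a (f t) y) Y
  hasDeriv : HasDerivWithinAt (fun s => f s y) (Q₁ a (f t) y - Q₂ a (f t) y) (Ici 0) t

/-- The weight `1 + m + p²`. -/
def weight (y : ℝ × ℝ) : ℝ := 1 + y.1 + y.2 ^ 2

/-- `f` is a nonnegative solution on `[0, ∞) × Y` of the coagulation equation with rate `a` and
initial datum `fin`: it is continuous in time with values in `L¹(Y, (1 + m + p²) dm dp)`, and for
almost every `y ∈ Y` the equation holds at every time. -/
structure IsSolution (a : ℝ × ℝ → ℝ × ℝ → ℝ) (fin : ℝ × ℝ → ℝ) (f : ℝ → ℝ × ℝ → ℝ) : Prop where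
  nonneg : ∀ t, 0 ≤ t → ∀ y ∈ Y, 0 ≤ f t y
  integrable : ∀ t, 0 ≤ t → IntegrableOn (fun y => weight y * f t y) Y
  continuous_L1 : ∀ t₀, 0 ≤ t₀ →
    Tendsto (fun t => ∫ y in Y, weight y * |f t y - f t₀ y|) (𝓝[Ici 0] t₀) (𝓝 0)
  initial : ∀ y ∈ Y, f 0 y = fin y
  equation : ∀ᵐ y ∂(volume.restrict Y), ∀ t, 0 ≤ t → SolvesAt a f t y

/-- The Laplace (in `m`) and Fourier (in `p`) transform
`∫_0^∞ ∫_ℝ e^{-mζ} e^{-ipξ} g(m, p) dp dm`. -/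
def fourierLaplace (g : ℝ × ℝ → ℝ) (ζ : ℂ) (ξ : ℝ) : ℂ :=
  ∫ y in Y, Complex.exp (-((y.1 : ℂ) * ζ)) * Complex.exp (-(Complex.I * (y.2 : ℂ) * (ξ : ℂ))) *
    (g y : ℂ)

/-- `g ∈ L¹(Y)` has Fourier–Laplace transform `G` on `{Re ζ ≥ 0} × ℝ`. -/
def HasFourierLaplace (g : ℝ × ℝ → ℝ) (G : ℂ → ℝ → ℂ) : Prop :=
  IntegrableOn g Y ∧ ∀ ζ : ℂ, 0 ≤ ζ.re → ∀ ξ : ℝ, fourierLaplace g ζ ξ = G ζ ξ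

/-- `g` is the inverse Fourier–Laplace transform of `G`: the function in `L¹(Y)`, unique up to
null sets, whose transform is `G`. -/
def IsInverseFourierLaplace (G : ℂ → ℝ → ℂ) (g : ℝ × ℝ → ℝ) : Prop :=
  HasFourierLaplace g G ∧
    ∀ g' : ℝ × ℝ → ℝ, HasFourierLaplace g' G → g' =ᵐ[volume.restrict Y] g

/-- The moments `M_{α,β}(g) = ∫_Y m^α |p|^β g dm dp`. -/
def moment (α β : ℝ) (g : ℝ × ℝ → ℝ) : ℝ := ∫ y in Y, y.1 ^ α * |y.2| ^ β * g y

/-- `H₀ = M_{0,0}(fin)⁻¹`. -/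
def H₀ (fin : ℝ × ℝ → ℝ) : ℝ := (moment 0 0 fin)⁻¹

/-- The factor `1 / F(0, ζ, ξ) - (H₀ t / 2) / (H₀ + t / 2)`, for `F(0, ζ, ξ) ≠ 0`. -/
def denomFactor (fin : ℝ × ℝ → ℝ) (t : ℝ) (ζ : ℂ) (ξ : ℝ) : ℂ :=
  1 / fourierLaplace fin ζ ξ - ((H₀ fin * t / 2 / (H₀ fin + t / 2) : ℝ) : ℂ)

/-- `F(t, ζ, ξ) = H₀² / ((H₀ + t/2)² (1 / F(0, ζ, ξ) - (H₀ t/2) / (H₀ + t/2)))`, where `F(0, ·, ·)`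
is the transform of the initial datum; where `F(0, ζ, ξ) = 0` the formula is read as `0`. -/
def explicitF (fin : ℝ × ℝ → ℝ) (t : ℝ) (ζ : ℂ) (ξ : ℝ) : ℂ :=
  if fourierLaplace fin ζ ξ = 0 then 0
  else (H₀ fin : ℂ) ^ 2 / (((H₀ fin + t / 2 : ℝ) : ℂ) ^ 2 * denomFactor fin t ζ ξ)

/-- `𝒜 = H₀² ∫_Y m fin dm dp`. -/
def calA (fin : ℝ × ℝ → ℝ) : ℝ := H₀ fin ^ 2 * ∫ y in Y, y.1 * fin y

/-- `ℬ = H₀² ∫_Y p² fin dm dp`. -/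
def calB (fin : ℝ × ℝ → ℝ) : ℝ := H₀ fin ^ 2 * ∫ y in Y, y.2 ^ 2 * fin y

/-- The profile
`φ_∞(m, p) = 4 H₀² / √(2 π 𝒜 ℬ) · e^{-2 H₀² m / 𝒜} e^{-𝒜 p² / (2 ℬ m)} / √m`. -/
def profile (fin : ℝ × ℝ → ℝ) (y : ℝ × ℝ) : ℝ :=
  4 * H₀ fin ^ 2 / Real.sqrt (2 * Real.pi * calA fin * calB fin) *
    (Real.exp (-(2 * H₀ fin ^ 2 * y.1 / calA fin)) *
      Real.exp (-(calA fin * y.2 ^ 2 / (2 * calB fin * y.1))) / Real.sqrt y.1)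

/-- The rescaled function `t^{5/2} f(t, t m, √t p)`. -/
def rescaled (f : ℝ → ℝ × ℝ → ℝ) (t : ℝ) (y : ℝ × ℝ) : ℝ :=
  t ^ (5 / 2 : ℝ) * f t (t * y.1, Real.sqrt t * y.2)

/-- Convergence, as `t → +∞`, of densities in `L¹(Y)` for the weak topology `σ(M¹(Y), C_c(Y))` of
measures on `Y`. -/
def WeaklyConverges (φ : ℝ → ℝ × ℝ → ℝ) (φlim : ℝ × ℝ → ℝ) : Prop :=
  (∀ᶠ t in atTop, IntegrableOn (φ t) Y) ∧ IntegrableOn φlim Y ∧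
    ∀ ψ : ℝ × ℝ → ℝ, Continuous ψ → HasCompactSupport ψ → tsupport ψ ⊆ Y →
      Tendsto (fun t => ∫ y in Y, ψ y * φ t y) atTop (𝓝 (∫ y in Y, ψ y * φlim y))

end Coag

end

/-! The solution is written down explicitly. Extend q = H₀ f_in by zero outside Y, so that q is a
probability density, and put x = (t/2)/(H₀ + t/2), c = H₀/(H₀ + t/2)². The claim is that f(t) = c ·
G_x with G_x = ∑ xⁿ q^{*(n+1)}; these are `sol` and `geomSum`.

The coefficient of xⁿ in G_x * G_x collects n + 1 copies of q^{*(n+2)}, hence ∂ₓ G_x = G_x * G_x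
(`geomSum_lconvolution`, `hasDerivAt_powerSeries`). Since x' = c/2 and c' = -c/(H₀ + t/2), where
1/(H₀ + t/2) is the total mass of f(t), the chain and product rules turn this identity into the
coagulation equation (`solvesAt_sol`). All terms are nonnegative, so sums and integrals are
exchanged in `ℝ≥0∞`, and the pointwise calculus takes place at the points where the series is finite
for every x < 1 (`Good`): almost every point in general, every point for bounded data. The weighted
mass of q^{*(n+1)} grows at most like (n + 1)², which xⁿ absorbs; this gives the moments and, by
domination, continuity in time.

The kernel of the transform is multiplicative, so with φ = H₀ F(0) the transform of G_x is the
geometric sum φ/(1 - xφ), which reproduces the explicit F (`fourierLaplace_sol`). The bound |φ| ≤ 1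
gives convergence and the nonvanishing of denominators. Uniqueness of the inverse transform already
follows from purely imaginary ζ, where it is injectivity of characteristic functions.

For long times, a second-order expansion of F(0) at the origin, with evenness removing the
first-order term in p, gives the limit of the transform at (iη/t, ξ/√t) (`tendsto_mul_explicitF`).
This limit is half the transform of the profile, computed from Gaussian and exponential integrals
(`fourierLaplace_profileFun`). After normalisation to probability densities, Lévy's continuity
theorem yields weak convergence. -/

open scoped ENNReal

namespace Coag

/-! ### Convolution powers, their moments, and the convolution square of the series -/

section

/-- The convolution powers of a density: `convPow q n` is the `(n + 1)`-fold convolution of `q`. -/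
noncomputable def convPow (q : ℝ × ℝ → ℝ≥0∞) : ℕ → ℝ × ℝ → ℝ≥0∞
  | 0 => q
  | n + 1 => lconvolution q (convPow q n) volume

/-- The power series `∑ xⁿ q^{*(n+1)}` of a density. -/
noncomputable def geomSum (q : ℝ × ℝ → ℝ≥0∞) (x : ℝ) (y : ℝ × ℝ) : ℝ≥0∞ :=
  ∑' n, ENNReal.ofReal x ^ n * convPow q n y

/-- A probability density on `Y`, extended by zero, with finite weighted mass. -/
structure IsDensity (q : ℝ × ℝ → ℝ≥0∞) : Prop where
  aemeasurable : AEMeasurable q volume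
  eq_zero : ∀ y ∉ Y, q y = 0
  lintegral_eq_one : ∫⁻ y, q y = 1
  weight_lt_top : ∫⁻ y, ENNReal.ofReal (weight y) * q y < ∞

lemma measurableSet_Y : MeasurableSet Y := measurableSet_Ioi.prod MeasurableSet.univ

lemma isOpen_Y : IsOpen Y := isOpen_Ioi.prod isOpen_univ

lemma mem_Y {y : ℝ × ℝ} : y ∈ Y ↔ 0 < y.1 := by simp [Y]

@[fun_prop]
lemma continuous_weight : Continuous weight := by unfold weight; fun_prop

lemma one_le_weight {y : ℝ × ℝ} (hy : y ∈ Y) : 1 ≤ weight y := by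
  have := mem_Y.1 hy
  unfold weight; nlinarith [sq_nonneg y.2]

variable {q : ℝ × ℝ → ℝ≥0∞}

lemma aemeasurable_convPow (hq : AEMeasurable q volume) (n : ℕ) :
    AEMeasurable (convPow q n) volume := by
  induction n with
  | zero => exact hq
  | succ n ih => exact aemeasurable_lconvolution hq ih

lemma convPow_lconvolution (hq : AEMeasurable q volume) (n m : ℕ) :
    lconvolution (convPow q n) (convPow q m) volume = convPow q (n + m + 1) := by
  induction n with
  | zero => simp [convPow]
  | succ n ih =>
    rw [show n + 1 + m + 1 = (n + m + 1) + 1 by ring]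
    change lconvolution (lconvolution q (convPow q n) volume) _ volume = lconvolution q _ volume
    rw [← ih, ← lconvolution_assoc₀ hq (aemeasurable_convPow hq n) (aemeasurable_convPow hq m)]

lemma convPow_eq_zero (hq : ∀ y ∉ Y, q y = 0) (n : ℕ) : ∀ y ∉ Y, convPow q n y = 0 := by
  induction n with
  | zero => exact hq
  | succ n ih =>
    intro y hy
    change ∫⁻ z, q z * convPow q n (-z + y) = 0
    have : ∀ z, q z * convPow q n (-z + y) = 0 := fun z => by
      by_cases hz : z ∈ Y
      · rw [ih, mul_zero]
        rw [mem_Y] at *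
        simp at *; linarith
      · rw [hq z hz, zero_mul]
    simp [this]

lemma geomSum_eq_zero (hq : ∀ y ∉ Y, q y = 0) (x : ℝ) : ∀ y ∉ Y, geomSum q x y = 0 := by
  intro y hy
  simp [geomSum, convPow_eq_zero hq _ y hy]

lemma aemeasurable_geomSum (hq : AEMeasurable q volume) (x : ℝ) :
    AEMeasurable (geomSum q x) volume :=
  AEMeasurable.tsum fun n => (aemeasurable_convPow hq n).const_mul _

lemma geomSum_zero (y : ℝ × ℝ) : geomSum q 0 y = q y := by
  unfold geomSum
  rw [tsum_eq_single 0]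
  · simp [convPow]
  · intro n hn; simp [hn]

lemma geomSum_mono {x x' : ℝ} (h : x ≤ x') (y : ℝ × ℝ) : geomSum q x y ≤ geomSum q x' y := by
  unfold geomSum
  gcongr

/-- The measure with density `convPow q n`. -/
noncomputable def convMeasure (q : ℝ × ℝ → ℝ≥0∞) (n : ℕ) : Measure (ℝ × ℝ) :=
  volume.withDensity (convPow q n)

/-- Bridge from densities to measures: total masses, moments and integrals of characters are
computed on the measure side. -/
lemma convMeasure_succ (hq : AEMeasurable q volume) (n : ℕ) :
    convMeasure q (n + 1) = (convMeasure q 0).conv (convMeasure q n) :=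
  (conv_withDensity_eq_mlconvolution₀ hq (aemeasurable_convPow hq n)).symm

lemma isProbabilityMeasure_convMeasure (hq : IsDensity q) (n : ℕ) :
    IsProbabilityMeasure (convMeasure q n) := by
  have h0 : IsProbabilityMeasure (convMeasure q 0) := ⟨by
    simp [convMeasure, convPow, hq.lintegral_eq_one]⟩
  induction n with
  | zero => exact h0
  | succ n ih => rw [convMeasure_succ hq.aemeasurable]; infer_instance

lemma lintegral_convPow (hq : IsDensity q) (n : ℕ) : ∫⁻ y, convPow q n y = 1 := by
  have := (isProbabilityMeasure_convMeasure hq n).measure_univ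
  simpa [convMeasure] using this

lemma ae_convMeasure_mem_Y (hq : IsDensity q) (n : ℕ) : ∀ᵐ y ∂(convMeasure q n), y ∈ Y := by
  have : convMeasure q n Yᶜ = 0 := by
    rw [convMeasure, withDensity_apply _ measurableSet_Y.compl]
    rw [setLIntegral_congr_fun measurableSet_Y.compl (g := fun _ => 0)]
    · simp
    · intro y hy; exact convPow_eq_zero hq.eq_zero n y hy
  rwa [ae_iff]

/-- Young's inequality 2pp' ≤ (n + 1)p² + p'²/(n + 1). The parameter n + 1 makes the induction on
moments close exactly: (n + 2) + (1 + 1/(n + 1))(n + 1)² = (n + 2)². -/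
lemma weight_add_le {y z : ℝ × ℝ} (hy : y ∈ Y) (hz : z ∈ Y) (n : ℕ) :
    weight (y + z) ≤ (n + 2) * weight y + (1 + 1 / (n + 1)) * weight z := by
  rw [mem_Y] at hy hz
  have hn : (0 : ℝ) < n + 1 := by positivity
  have key : (y.2 + z.2) ^ 2 ≤ (n + 2) * y.2 ^ 2 + (1 + 1 / (n + 1)) * z.2 ^ 2 := by
    have : (n + 2) * y.2 ^ 2 + (1 + 1 / (n + 1)) * z.2 ^ 2 - (y.2 + z.2) ^ 2
      = ((n + 1) * y.2 - z.2) ^ 2 / (n + 1) := by field_simp; ring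
    have h2 : 0 ≤ ((n + 1) * y.2 - z.2) ^ 2 / (n + 1 : ℝ) := by positivity
    linarith
  have h1 : (0 : ℝ) ≤ 1 / (n + 1) := by positivity
  have h3 : (0 : ℝ) ≤ n := by positivity
  unfold weight
  simp only [Prod.fst_add, Prod.snd_add]
  nlinarith [mul_nonneg h1 hz.le, mul_nonneg h3 hy.le]

lemma lintegral_convMeasure (hq : AEMeasurable q volume) (n : ℕ) (φ : ℝ × ℝ → ℝ≥0∞)
    (hφ : Measurable φ) : ∫⁻ y, φ y ∂(convMeasure q n) = ∫⁻ y, φ y * convPow q n y := by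
  rw [convMeasure, lintegral_withDensity_eq_lintegral_mul₀ (aemeasurable_convPow hq n)
    hφ.aemeasurable]
  simp [mul_comm]

/-- Split off one factor of q and integrate `weight_add_le`; both factors have mass one. Any
polynomial growth would do, since it is summed against xⁿ with x < 1. -/
lemma lintegral_weight_convPow_le (hq : IsDensity q) (n : ℕ) :
    ∫⁻ y, ENNReal.ofReal (weight y) * convPow q n y ≤
      (n + 1 : ℝ≥0∞) ^ 2 * ∫⁻ y, ENNReal.ofReal (weight y) * q y := by
  have hm : Measurable fun y => ENNReal.ofReal (weight y) :=
    ENNReal.measurable_ofReal.comp continuous_weight.measurable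
  induction n with
  | zero => simp [convPow]
  | succ n ih =>
    have := isProbabilityMeasure_convMeasure hq n
    have := isProbabilityMeasure_convMeasure hq 0
    set W := ∫⁻ y, ENNReal.ofReal (weight y) * q y with hW
    have e0 : ∫⁻ y, ENNReal.ofReal (weight y) ∂(convMeasure q 0) = W :=
      lintegral_convMeasure hq.aemeasurable 0 _ hm
    rw [← lintegral_convMeasure hq.aemeasurable _ _ hm] at ih ⊢
    rw [convMeasure_succ hq.aemeasurable, Measure.lintegral_conv hm]
    calc ∫⁻ x, ∫⁻ y, ENNReal.ofReal (weight (x + y)) ∂(convMeasure q n) ∂(convMeasure q 0)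
        ≤ ∫⁻ x, ∫⁻ y, (ENNReal.ofReal (n + 2) * ENNReal.ofReal (weight x)
            + ENNReal.ofReal (1 + 1 / (n + 1)) * ENNReal.ofReal (weight y))
            ∂(convMeasure q n) ∂(convMeasure q 0) := by
          refine lintegral_mono_ae ?_
          filter_upwards [ae_convMeasure_mem_Y hq 0] with x hx
          refine lintegral_mono_ae ?_
          filter_upwards [ae_convMeasure_mem_Y hq n] with y hy
          have h1 := one_le_weight hx
          have h2 := one_le_weight hy
          rw [← ENNReal.ofReal_mul (by positivity), ← ENNReal.ofReal_mul (by positivity),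
            ← ENNReal.ofReal_add (by positivity) (by positivity)]
          exact ENNReal.ofReal_le_ofReal (weight_add_le hx hy n)
      _ = ENNReal.ofReal (n + 2) * W + ENNReal.ofReal (1 + 1 / (n + 1)) *
            ∫⁻ y, ENNReal.ofReal (weight y) ∂(convMeasure q n) := by
          have : ∀ x, ∫⁻ y, (ENNReal.ofReal (n + 2) * ENNReal.ofReal (weight x)
            + ENNReal.ofReal (1 + 1 / (n + 1)) * ENNReal.ofReal (weight y)) ∂(convMeasure q n)
              = ENNReal.ofReal (n + 2) * ENNReal.ofReal (weight x) +
              ENNReal.ofReal (1 + 1 / (n + 1)) *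
                ∫⁻ y, ENNReal.ofReal (weight y) ∂(convMeasure q n) := by
            intro x
            rw [lintegral_add_left (by fun_prop), lintegral_const, measure_univ, mul_one,
              lintegral_const_mul _ hm]
          simp_rw [this]
          rw [lintegral_add_left (by fun_prop), lintegral_const, measure_univ, mul_one,
              lintegral_const_mul _ hm, e0]
      _ ≤ ENNReal.ofReal (n + 2) * W + ENNReal.ofReal (1 + 1 / (n + 1)) *
            ((n + 1 : ℝ≥0∞) ^ 2 * W) := by gcongr
      _ = ((n + 1 : ℕ) + 1 : ℝ≥0∞) ^ 2 * W := by
          rw [← mul_assoc, ← add_mul]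
          congr 1
          have e1 : (n + 1 : ℝ≥0∞) ^ 2 = ENNReal.ofReal ((n + 1) ^ 2) := by
            rw [ENNReal.ofReal_pow (by positivity),
              ENNReal.ofReal_add (by positivity) (by positivity)]
            simp
          have e2 : ((n + 1 : ℕ) + 1 : ℝ≥0∞) ^ 2 = ENNReal.ofReal ((n + 2) ^ 2) := by
            rw [ENNReal.ofReal_pow (by positivity),
              show (n + 2 : ℝ) = ((n + 2 : ℕ) : ℝ) by push_cast; rfl, ENNReal.ofReal_natCast]
            congr 1
            push_cast
            ring
          rw [e1, e2, ← ENNReal.ofReal_mul (by positivity),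
            ← ENNReal.ofReal_add (by positivity) (by positivity)]
          congr 1
          field_simp
          ring

lemma tsum_pow_mul_sq_lt_top {x : ℝ} (hx : 0 ≤ x) (hx1 : x < 1) :
    ∑' n : ℕ, ENNReal.ofReal x ^ n * (n + 1 : ℝ≥0∞) ^ 2 < ∞ := by
  have hs : Summable fun n : ℕ => x ^ n * ((n : ℝ) + 1) ^ 2 := by
    have h := summable_pow_mul_geometric_of_norm_lt_one (R := ℝ) 2 (r := x)
      (by rwa [Real.norm_of_nonneg hx])
    have h1 := summable_pow_mul_geometric_of_norm_lt_one (R := ℝ) 1 (r := x)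
      (by rwa [Real.norm_of_nonneg hx])
    have h0 := summable_geometric_of_lt_one hx hx1
    refine ((h.add (h1.mul_left 2)).add h0).congr fun n => ?_
    ring
  have e : ∀ n : ℕ, ENNReal.ofReal x ^ n * (n + 1 : ℝ≥0∞) ^ 2
      = ENNReal.ofReal (x ^ n * ((n : ℝ) + 1) ^ 2) := fun n => by
    rw [ENNReal.ofReal_mul (by positivity), ENNReal.ofReal_pow hx,
      ENNReal.ofReal_pow (by positivity), ENNReal.ofReal_add (by positivity) (by positivity)]
    simp
  simp_rw [e]
  exact hs.tsum_ofReal_lt_top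

lemma lintegral_weight_geomSum_lt_top (hq : IsDensity q) {x : ℝ} (hx : 0 ≤ x) (hx1 : x < 1) :
    ∫⁻ y, ENNReal.ofReal (weight y) * geomSum q x y < ∞ := by
  have hm : Measurable fun y => ENNReal.ofReal (weight y) :=
    ENNReal.measurable_ofReal.comp continuous_weight.measurable
  unfold geomSum
  simp_rw [← ENNReal.tsum_mul_left]
  rw [lintegral_tsum fun n => by
    have := aemeasurable_convPow hq.aemeasurable n
    fun_prop]
  calc ∑' n, ∫⁻ y, ENNReal.ofReal (weight y) * (ENNReal.ofReal x ^ n * convPow q n y)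
      ≤ ∑' n : ℕ, ENNReal.ofReal x ^ n * (n + 1 : ℝ≥0∞) ^ 2 *
          ∫⁻ y, ENNReal.ofReal (weight y) * q y := by
        refine ENNReal.tsum_le_tsum fun n => ?_
        simp_rw [mul_left_comm (ENNReal.ofReal (weight _))]
        rw [lintegral_const_mul' _ _ (by simp), mul_assoc]
        gcongr
        exact lintegral_weight_convPow_le hq n
    _ < ∞ := by
        rw [ENNReal.tsum_mul_right]
        exact ENNReal.mul_lt_top (tsum_pow_mul_sq_lt_top hx hx1) hq.weight_lt_top

lemma lintegral_geomSum (hq : IsDensity q) (x : ℝ) :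
    ∫⁻ y, geomSum q x y = (1 - ENNReal.ofReal x)⁻¹ := by
  unfold geomSum
  rw [lintegral_tsum fun n => (aemeasurable_convPow hq.aemeasurable n).const_mul _]
  simp_rw [lintegral_const_mul' _ _ (ENNReal.pow_ne_top ENNReal.ofReal_ne_top),
    lintegral_convPow hq, mul_one]
  exact ENNReal.tsum_geometric _

/-- The points at which the power series `geomSum q` converges in `[0, 1)`. -/
def Good (q : ℝ × ℝ → ℝ≥0∞) (y : ℝ × ℝ) : Prop :=
  ∀ x : ℝ, 0 ≤ x → x < 1 → geomSum q x y < ∞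

lemma ae_geomSum_lt_top (hq : IsDensity q) {x : ℝ} (hx1 : x < 1) :
    ∀ᵐ y, geomSum q x y < ∞ := by
  refine ae_lt_top' (aemeasurable_geomSum hq.aemeasurable x) ?_
  rw [lintegral_geomSum hq]
  rw [ENNReal.inv_ne_top, ← pos_iff_ne_zero, tsub_pos_iff_lt]
  exact ENNReal.ofReal_lt_one.2 hx1

/-- The series increases with x, so the countably many values x = 1 - 1/(k + 1) control all x < 1
outside a single null set, independent of time. -/
lemma ae_good (hq : IsDensity q) : ∀ᵐ y, Good q y := by
  have h : ∀ᵐ y, ∀ k : ℕ, geomSum q (1 - 1 / (k + 1)) y < ∞ :=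
    ae_all_iff.2 fun k => ae_geomSum_lt_top hq (by
      have : (0 : ℝ) < 1 / (k + 1) := by positivity
      linarith)
  filter_upwards [h] with y hy x _ hx1
  obtain ⟨k, hk⟩ := exists_nat_one_div_lt (sub_pos.2 hx1)
  exact (geomSum_mono (by linarith) y).trans_lt (hy k)

/-- Cauchy product: the product of the terms of index i and j depends only on i + j, and each
antidiagonal i + j = n has n + 1 points. The right-hand side is the formal x-derivative of the
series. -/
lemma geomSum_lconvolution (hq : AEMeasurable q volume) (x : ℝ) (y : ℝ × ℝ) :
    lconvolution (geomSum q x) (geomSum q x) volume y =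
      ∑' n : ℕ, (n + 1 : ℝ≥0∞) * (ENNReal.ofReal x ^ n * convPow q (n + 1) y) := by
  have hm := aemeasurable_convPow hq
  have hr : ∀ n, AEMeasurable (fun z => convPow q n (-z + y)) volume := fun n =>
    (hm n).comp_quasiMeasurePreserving
      (((measurePreserving_add_right volume y).comp
        (Measure.measurePreserving_neg volume)).quasiMeasurePreserving)
  set a := ENNReal.ofReal x
  calc ∫⁻ z, geomSum q x z * geomSum q x (-z + y)
      = ∫⁻ z, ∑' n, ∑' m, (a ^ (n + m) * (convPow q n z * convPow q m (-z + y))) := by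
        refine lintegral_congr fun z => ?_
        unfold geomSum
        rw [← ENNReal.tsum_mul_right]
        refine tsum_congr fun n => ?_
        rw [← ENNReal.tsum_mul_left]
        refine tsum_congr fun m => ?_
        rw [pow_add]; ring
    _ = ∑' n, ∑' m, a ^ (n + m) * convPow q (n + m + 1) y := by
        rw [lintegral_tsum fun n => by
          have := hm n
          exact AEMeasurable.tsum fun m => by have := hr m; fun_prop]
        refine tsum_congr fun n => ?_
        rw [lintegral_tsum fun m => by have := hm n; have := hr m; fun_prop]
        refine tsum_congr fun m => ?_
        rw [lintegral_const_mul' _ _ (ENNReal.pow_ne_top ENNReal.ofReal_ne_top),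
          ← convPow_lconvolution hq]
        rfl
    _ = ∑' n : ℕ, ∑' p : Finset.HasAntidiagonal.antidiagonal n,
          a ^ (p.1.1 + p.1.2) * convPow q (p.1.1 + p.1.2 + 1) y := by
        rw [← ENNReal.tsum_prod (f := fun n m : ℕ => a ^ (n + m) * convPow q (n + m + 1) y),
          ← (Finset.HasAntidiagonal.sigmaAntidiagonalEquivProd (A := ℕ)).tsum_eq, ENNReal.tsum_sigma']
        rfl
    _ = _ := by
        refine tsum_congr fun n => ?_
        rw [Finset.tsum_subtype (Finset.HasAntidiagonal.antidiagonal n)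
          (fun p : ℕ × ℕ => a ^ (p.1 + p.2) * convPow q (p.1 + p.2 + 1) y)]
        rw [Finset.sum_congr rfl (g := fun _ => a ^ n * convPow q (n + 1) y)]
        · simp
        · intro p hp
          rw [Finset.HasAntidiagonal.mem_antidiagonal.1 hp]

end

/-! ### Differentiating the series in x, and the coagulation equation -/

section

lemma summable_succ_mul_pow {v : ℕ → ℝ}
    (h : ∀ x : ℝ, 0 ≤ x → x < 1 → Summable fun n => x ^ n * v n) {x : ℝ} (hx : 0 ≤ x)
    (hx1 : x < 1) : Summable fun n : ℕ => ((n : ℝ) + 1) * (x ^ n * v (n + 1)) := by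
  obtain ⟨R, hR, hR1⟩ := exists_between hx1
  have hR0 : 0 < R := hx.trans_lt hR
  have hr : ‖x / R‖ < 1 := by
    rw [Real.norm_of_nonneg (by positivity)]
    exact (div_lt_one hR0).2 hR
  have h1 : Summable fun n : ℕ => ((n : ℝ) + 1) * (x / R) ^ n := by
    have ha := summable_pow_mul_geometric_of_norm_lt_one (R := ℝ) 1 hr
    refine (ha.add (summable_geometric_of_norm_lt_one hr)).congr fun n => ?_
    ring
  have h2 : Summable fun n : ℕ => R ^ n * v (n + 1) := by
    have := ((summable_nat_add_iff 1).2 (h R hR0.le hR1)).mul_left R⁻¹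
    refine this.congr fun n => ?_
    rw [pow_succ]; field_simp
  -- With x < R < 1 the general term factors as (n + 1)(x/R)ⁿ times Rⁿ v(n + 1); it is the diagonal
  -- of a summable double family.
  have h3 := summable_mul_of_summable_norm h1.norm h2.norm
  have h4 := h3.comp_injective (i := fun n : ℕ => (n, n)) fun a b hab => (Prod.ext_iff.1 hab).1
  refine h4.congr fun n => ?_
  simp only [Function.comp_apply, div_pow]
  field_simp

/-- Termwise differentiation on a ball of radius r with x < r < 1, where the derivatives are
dominated by their values at r. The ball contains negative numbers, so the derivative is two-sided
even at x = 0. -/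
lemma hasDerivAt_powerSeries {v : ℕ → ℝ} (hv : ∀ n, 0 ≤ v n)
    (h : ∀ x : ℝ, 0 ≤ x → x < 1 → Summable fun n => x ^ n * v n) {x : ℝ} (hx : 0 ≤ x)
    (hx1 : x < 1) :
    HasDerivAt (fun z : ℝ => ∑' n, z ^ n * v n)
      (∑' n : ℕ, ((n : ℝ) + 1) * (x ^ n * v (n + 1))) x := by
  obtain ⟨r, hr, hr1⟩ := exists_between hx1
  have hr0 : 0 < r := hx.trans_lt hr
  have hu : Summable fun n : ℕ => (n : ℝ) * r ^ (n - 1) * v n := by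
    rw [← summable_nat_add_iff 1]
    refine (summable_succ_mul_pow h hr0.le hr1).congr fun n => ?_
    simp [mul_assoc]
  have hxr : x ∈ Metric.ball (0 : ℝ) r := by simpa [abs_of_nonneg hx] using hr
  have hb : ∀ (n : ℕ) (z : ℝ), z ∈ Metric.ball (0 : ℝ) r →
      ‖(n : ℝ) * z ^ (n - 1) * v n‖ ≤ n * r ^ (n - 1) * v n := fun n z hz => by
    have hz' : |z| ≤ r := by simpa using (mem_ball_zero_iff.1 hz).le
    rw [norm_mul, norm_mul, norm_pow, Real.norm_of_nonneg (hv n), Real.norm_natCast,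
      Real.norm_eq_abs]
    have := hv n
    gcongr
  have hs : Summable fun n : ℕ => (n : ℝ) * x ^ (n - 1) * v n :=
    Summable.of_norm_bounded hu fun n => hb n x hxr
  refine (hasDerivAt_tsum_of_isPreconnected (g := fun n z => z ^ n * v n)
    (g' := fun n z => n * z ^ (n - 1) * v n) hu Metric.isOpen_ball
    (convex_ball (0 : ℝ) r).isPreconnected
    (fun n z _ => (hasDerivAt_pow n z).mul_const (v n)) hb hxr (h x hx hx1) hxr).congr_deriv ?_
  rw [hs.tsum_eq_zero_add]
  simp [mul_assoc]

variable {q : ℝ × ℝ → ℝ≥0∞} {y : ℝ × ℝ}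

lemma Good.convPow_ne_top (hy : Good q y) (n : ℕ) : convPow q n y ≠ ∞ := by
  intro h
  have h1 := hy (1 / 2) (by norm_num) (by norm_num)
  have h2 := (ENNReal.le_tsum n).trans_lt h1
  rw [h, ENNReal.mul_top] at h2
  · exact lt_irrefl _ h2
  · simp

lemma geomSum_toReal (hy : Good q y) {x : ℝ} (hx : 0 ≤ x) :
    (geomSum q x y).toReal = ∑' n, x ^ n * (convPow q n y).toReal := by
  unfold geomSum
  rw [ENNReal.tsum_toReal_eq]
  · simp [hx]
  · intro n
    exact ENNReal.mul_ne_top (ENNReal.pow_ne_top ENNReal.ofReal_ne_top) (hy.convPow_ne_top n)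

lemma Good.summable (hy : Good q y) (x : ℝ) (hx : 0 ≤ x) (hx1 : x < 1) :
    Summable fun n => x ^ n * (convPow q n y).toReal := by
  have := ENNReal.summable_toReal (hy x hx hx1).ne
  simpa [hx] using this

/-- Only one-sided at 0: `ENNReal.ofReal` truncates negative arguments, so `geomSum` agrees with the
real power series only for z ≥ 0. -/
lemma hasDerivWithinAt_geomSum (hy : Good q y) {x : ℝ} (hx : 0 ≤ x) (hx1 : x < 1) :
    HasDerivWithinAt (fun z => (geomSum q z y).toReal)
      (∑' n : ℕ, ((n : ℝ) + 1) * (x ^ n * (convPow q (n + 1) y).toReal)) (Ici 0) x :=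
  (hasDerivAt_powerSeries (fun _ => ENNReal.toReal_nonneg) hy.summable hx hx1).hasDerivWithinAt.congr
    (fun _ hz => geomSum_toReal hy hz) (geomSum_toReal hy hx)

/-- Together with `hasDerivWithinAt_geomSum` this is ∂ₓ G = G * G at every good point; finiteness of
the right-hand side also gives absolute convergence of the gain integral. -/
lemma lintegral_geomSum_mul_geomSum (hq : AEMeasurable q volume) (hy : Good q y) {x : ℝ}
    (hx : 0 ≤ x) (hx1 : x < 1) :
    ∫⁻ z, geomSum q x z * geomSum q x (y - z) =
      ENNReal.ofReal (∑' n : ℕ, ((n : ℝ) + 1) * (x ^ n * (convPow q (n + 1) y).toReal)) := by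
  have h := geomSum_lconvolution hq x y
  rw [lconvolution] at h
  simp_rw [neg_add_eq_sub] at h
  rw [h, ENNReal.ofReal_tsum_of_nonneg (fun n => by positivity)
    (summable_succ_mul_pow hy.summable hx hx1)]
  refine tsum_congr fun n => ?_
  rw [ENNReal.ofReal_mul (by positivity), ENNReal.ofReal_mul (by positivity),
    ENNReal.ofReal_toReal (hy.convPow_ne_top _), ENNReal.ofReal_pow hx,
    ENNReal.ofReal_add (by positivity) (by positivity)]
  simp

lemma integrable_geomSum_mul_geomSum (hq : AEMeasurable q volume) (hy : Good q y) {x : ℝ}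
    (hx : 0 ≤ x) (hx1 : x < 1) :
    Integrable fun z => (geomSum q x z).toReal * (geomSum q x (y - z)).toReal := by
  have hm := aemeasurable_geomSum hq x
  have hr : AEMeasurable (fun z => geomSum q x (y - z)) volume :=
    hm.comp_quasiMeasurePreserving (Measure.measurePreserving_sub_left volume y).quasiMeasurePreserving
  simp_rw [← ENNReal.toReal_mul]
  refine integrable_toReal_of_lintegral_ne_top (by fun_prop) ?_
  rw [lintegral_geomSum_mul_geomSum hq hy hx hx1]
  exact ENNReal.ofReal_ne_top

lemma integral_geomSum_mul_geomSum (hq : AEMeasurable q volume) (hy : Good q y) {x : ℝ}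
    (hx : 0 ≤ x) (hx1 : x < 1) :
    ∫ z, (geomSum q x z).toReal * (geomSum q x (y - z)).toReal =
      ∑' n : ℕ, ((n : ℝ) + 1) * (x ^ n * (convPow q (n + 1) y).toReal) := by
  have hm := aemeasurable_geomSum hq x
  have hr : AEMeasurable (fun z => geomSum q x (y - z)) volume :=
    hm.comp_quasiMeasurePreserving (Measure.measurePreserving_sub_left volume y).quasiMeasurePreserving
  have hl := lintegral_geomSum_mul_geomSum hq hy hx hx1
  have hp : AEMeasurable (fun z => geomSum q x z * geomSum q x (y - z)) volume := by fun_prop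
  simp_rw [← ENNReal.toReal_mul]
  rw [integral_toReal hp (ae_lt_top' hp (by rw [hl]; exact ENNReal.ofReal_ne_top)), hl,
    ENNReal.toReal_ofReal]
  exact tsum_nonneg fun n => by positivity

/-- The ratio `(t / 2) / (H + t / 2)`. -/
noncomputable def ratio (H t : ℝ) : ℝ := t / 2 / (H + t / 2)

/-- The solution with initial datum `q / H`. -/
noncomputable def sol (q : ℝ × ℝ → ℝ≥0∞) (H t : ℝ) (y : ℝ × ℝ) : ℝ :=
  H / (H + t / 2) ^ 2 * (geomSum q (ratio H t) y).toReal

variable {H t : ℝ}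

lemma ratio_nonneg (hH : 0 < H) (ht : 0 ≤ t) : 0 ≤ ratio H t := by
  unfold ratio; positivity

lemma one_sub_ratio (hH : 0 < H) (ht : 0 ≤ t) : 1 - ratio H t = H / (H + t / 2) := by
  have : 0 < H + t / 2 := by positivity
  unfold ratio; field_simp; ring

lemma ratio_lt_one (hH : 0 < H) (ht : 0 ≤ t) : ratio H t < 1 := by
  have h := one_sub_ratio hH ht
  have : 0 < H / (H + t / 2) := by positivity
  linarith

lemma ratio_mono (hH : 0 < H) {t' : ℝ} (ht : 0 ≤ t) (h : t ≤ t') : ratio H t ≤ ratio H t' := by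
  have h1 := one_sub_ratio hH ht
  have h2 := one_sub_ratio hH (ht.trans h)
  have : H / (H + t' / 2) ≤ H / (H + t / 2) := by gcongr
  linarith

lemma sol_nonneg (hH : 0 < H) : 0 ≤ sol q H t y := by unfold sol; positivity

lemma sol_eq_zero (hq : ∀ y ∉ Y, q y = 0) (hy : y ∉ Y) : sol q H t y = 0 := by
  simp [sol, geomSum_eq_zero hq _ y hy]

lemma sol_zero (hH : 0 < H) : sol q H 0 y = (q y).toReal / H := by
  simp [sol, ratio, geomSum_zero]; field_simp

lemma integrable_geomSum_toReal (hq : IsDensity q) {x : ℝ} (hx1 : x < 1) :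
    Integrable fun y => (geomSum q x y).toReal := by
  refine integrable_toReal_of_lintegral_ne_top (aemeasurable_geomSum hq.aemeasurable x) ?_
  rw [lintegral_geomSum hq, ENNReal.inv_ne_top, ← pos_iff_ne_zero, tsub_pos_iff_lt]
  exact ENNReal.ofReal_lt_one.2 hx1

lemma integrable_sol (hq : IsDensity q) (hH : 0 < H) (ht : 0 ≤ t) : Integrable (sol q H t) :=
  (integrable_geomSum_toReal hq (ratio_lt_one hH ht)).const_mul _

lemma integral_geomSum_toReal (hq : IsDensity q) {x : ℝ} (hx : 0 ≤ x) (hx1 : x < 1) :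
    ∫ y, (geomSum q x y).toReal = (1 - x)⁻¹ := by
  rw [integral_toReal (aemeasurable_geomSum hq.aemeasurable x) (ae_geomSum_lt_top hq hx1),
    lintegral_geomSum hq, ENNReal.toReal_inv, ENNReal.toReal_sub_of_le]
  · simp [hx]
  · exact ENNReal.ofReal_le_one.2 hx1.le
  · simp

lemma integral_sol (hq : IsDensity q) (hH : 0 < H) (ht : 0 ≤ t) :
    ∫ y, sol q H t y = 1 / (H + t / 2) := by
  have : 0 < H + t / 2 := by positivity
  unfold sol
  rw [integral_const_mul, integral_geomSum_toReal hq (ratio_nonneg hH ht) (ratio_lt_one hH ht),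
    one_sub_ratio hH ht]
  field_simp

lemma setIntegral_Y_sol (hq : IsDensity q) (hH : 0 < H) (ht : 0 ≤ t) :
    ∫ y in Y, sol q H t y = 1 / (H + t / 2) := by
  rw [setIntegral_eq_integral_of_forall_compl_eq_zero fun y hy => sol_eq_zero hq.eq_zero hy,
    integral_sol hq hH ht]

lemma integrableOn_weight_geomSum (hq : IsDensity q) {x : ℝ} (hx : 0 ≤ x) (hx1 : x < 1) :
    IntegrableOn (fun y => weight y * (geomSum q x y).toReal) Y := by
  have hm : AEMeasurable (fun y => ENNReal.ofReal (weight y) * geomSum q x y) volume := by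
    have := aemeasurable_geomSum hq.aemeasurable x
    fun_prop
  have h := integrable_toReal_of_lintegral_ne_top hm
    (lintegral_weight_geomSum_lt_top hq hx hx1).ne
  refine h.integrableOn.congr_fun (fun y hy => ?_) measurableSet_Y
  have := one_le_weight hy
  simp only [ENNReal.toReal_mul]
  rw [ENNReal.toReal_ofReal (by linarith)]

/-- With c = H/(H + t/2)², the ratio has derivative c/2 and the prefactor has derivative -c/(H +
t/2). The first produces the gain term with its factor 1/2, the second the loss term. -/
lemma hasDerivWithinAt_sol (hy : Good q y) (hH : 0 < H) (ht : 0 ≤ t) :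
    HasDerivWithinAt (fun s => sol q H s y)
      (1 / 2 * (H / (H + t / 2) ^ 2) ^ 2 *
        (∑' n : ℕ, ((n : ℝ) + 1) * (ratio H t ^ n * (convPow q (n + 1) y).toReal))
        - sol q H t y * (1 / (H + t / 2))) (Ici 0) t := by
  have hs : H + t / 2 ≠ 0 := by positivity
  have d0 : HasDerivAt (fun s : ℝ => H + s / 2) (1 / 2) t := by
    simpa using ((hasDerivAt_id t).div_const 2).const_add H
  have d1 : HasDerivAt (ratio H) (H / 2 / (H + t / 2) ^ 2) t := by
    refine (((hasDerivAt_id t).div_const 2).div d0 hs).congr_deriv ?_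
    simp only [id]
    field_simp
    ring
  have d2 : HasDerivAt (fun s : ℝ => H / (H + s / 2) ^ 2) (-(H / (H + t / 2) ^ 3)) t := by
    refine ((hasDerivAt_const t H).div (d0.pow 2) (pow_ne_zero 2 hs)).congr_deriv ?_
    simp only [Pi.pow_apply]
    field_simp
    ring
  have d3 := HasDerivWithinAt.scomp (h := ratio H) (s := Ici 0) (t' := Ici 0) t
    (hasDerivWithinAt_geomSum hy (ratio_nonneg hH ht) (ratio_lt_one hH ht)) d1.hasDerivWithinAt
    (fun s hs => ratio_nonneg hH hs)
  refine (d2.hasDerivWithinAt.mul d3).congr_deriv ?_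
  simp only [sol, Function.comp_apply, smul_eq_mul]
  field_simp
  ring

lemma solvesAt_sol (hq : IsDensity q) (hH : 0 < H) (ht : 0 ≤ t) (hy : Good q y) :
    SolvesAt (fun _ _ => 1) (sol q H) t y := by
  have hx := ratio_nonneg hH ht
  have hx1 := ratio_lt_one hH ht
  have e : gainIntegrand (fun _ _ => 1) (sol q H t) y = fun z =>
      (H / (H + t / 2) ^ 2) ^ 2 *
        ((geomSum q (ratio H t) z).toReal * (geomSum q (ratio H t) (y - z)).toReal) := by
    ext z; simp only [gainIntegrand, sol]; ring
  have e' : lossIntegrand (fun _ _ => 1) (sol q H t) y = fun z => sol q H t y * sol q H t z := by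
    ext z; simp [lossIntegrand]
  have hi : Integrable (gainIntegrand (fun _ _ => 1) (sol q H t) y) := by
    rw [e]; exact (integrable_geomSum_mul_geomSum hq.aemeasurable hy hx hx1).const_mul _
  refine ⟨hi.integrableOn, ?_, ?_⟩
  · rw [e']; exact ((integrable_sol hq hH ht).const_mul _).integrableOn
  · refine (hasDerivWithinAt_sol hy hH ht).congr_deriv ?_
    congr 1
    · rw [Q₁, setIntegral_eq_integral_of_forall_compl_eq_zero, e, integral_const_mul,
        integral_geomSum_mul_geomSum hq.aemeasurable hy hx hx1]
      · ring
      · intro z hz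
        -- Outside the strip 0 < m' < m, either z or y - z leaves Y, where the solution vanishes;
        -- the gain integral is therefore a full convolution.
        simp only [gainIntegrand, one_mul, mul_eq_zero]
        by_cases h1 : z ∈ Y
        · right
          refine sol_eq_zero hq.eq_zero ?_
          rw [mem_Y] at *
          simp only [mem_prod, mem_Ioo, mem_univ, and_true, not_and, not_lt, Prod.fst_sub,
            sub_nonpos] at *
          exact hz h1
        · left; exact sol_eq_zero hq.eq_zero h1
    · rw [Q₂, e', integral_const_mul, setIntegral_Y_sol hq hH ht]

/-- Dominated convergence. For t ≤ t₀ + 1, monotonicity in x bounds the solution by 1/H times the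
series at the ratio of time t₀ + 1, whose weighted integral is finite; pointwise convergence comes
from differentiability at good points. -/
lemma tendsto_weighted_sol (hq : IsDensity q) (hH : 0 < H) {t₀ : ℝ} (ht₀ : 0 ≤ t₀) :
    Tendsto (fun t => ∫ y in Y, weight y * |sol q H t y - sol q H t₀ y|) (𝓝[Ici 0] t₀) (𝓝 0) := by
  have h1 := ratio_nonneg hH (t := t₀ + 1) (by linarith)
  have h2 := ratio_lt_one hH (t := t₀ + 1) (by linarith)
  have hle : ∀ y, Good q y → ∀ t, 0 ≤ t → t ≤ t₀ + 1 →
      sol q H t y ≤ 1 / H * (geomSum q (ratio H (t₀ + 1)) y).toReal := by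
    intro y hy t ht ht1
    unfold sol
    have a1 : H / (H + t / 2) ^ 2 ≤ 1 / H := by
      rw [div_le_div_iff₀ (by positivity) hH]
      nlinarith [mul_nonneg hH.le ht]
    have a2 : (geomSum q (ratio H t) y).toReal ≤ (geomSum q (ratio H (t₀ + 1)) y).toReal :=
      ENNReal.toReal_mono (hy _ h1 h2).ne (geomSum_mono (ratio_mono hH ht ht1) y)
    gcongr
  have hmeas : ∀ t, 0 ≤ t → AEStronglyMeasurable (sol q H t) (volume.restrict Y) := fun t ht =>
    (integrable_sol hq hH ht).aestronglyMeasurable.restrict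
  have hev : ∀ᶠ t in 𝓝[Ici 0] t₀, 0 ≤ t ∧ t ≤ t₀ + 1 := by
    refine eventually_mem_nhdsWithin.and (eventually_nhdsWithin_of_eventually_nhds ?_)
    exact (eventually_lt_nhds (by linarith)).mono fun _ h => le_of_lt h
  have key := tendsto_integral_filter_of_dominated_convergence (μ := volume.restrict Y)
    (l := 𝓝[Ici 0] t₀) (F := fun t y => weight y * |sol q H t y - sol q H t₀ y|) (f := fun _ => 0)
    (fun y => 2 / H * (weight y * (geomSum q (ratio H (t₀ + 1)) y).toReal)) ?_ ?_ ?_ ?_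
  · simpa using key
  · filter_upwards [hev] with t ht
    exact continuous_weight.aestronglyMeasurable.mul
      (((hmeas t ht.1).sub (hmeas t₀ ht₀)).norm)
  · filter_upwards [hev] with t ht
    filter_upwards [ae_restrict_of_ae (ae_good hq), ae_restrict_mem measurableSet_Y] with y hy hyY
    have b1 := hle y hy t ht.1 ht.2
    have b2 := hle y hy t₀ ht₀ (by linarith)
    have b3 : 0 ≤ sol q H t y := sol_nonneg hH
    have b4 : 0 ≤ sol q H t₀ y := sol_nonneg hH
    have b5 := one_le_weight hyY
    rw [norm_mul, Real.norm_of_nonneg (by linarith), Real.norm_of_nonneg (abs_nonneg _)]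
    have b6 : |sol q H t y - sol q H t₀ y| ≤
        2 / H * (geomSum q (ratio H (t₀ + 1)) y).toReal := by
      have : 2 / H * (geomSum q (ratio H (t₀ + 1)) y).toReal =
        1 / H * (geomSum q (ratio H (t₀ + 1)) y).toReal
          + 1 / H * (geomSum q (ratio H (t₀ + 1)) y).toReal := by ring
      rw [abs_le]; constructor <;> linarith
    calc weight y * |sol q H t y - sol q H t₀ y|
        ≤ weight y * (2 / H * (geomSum q (ratio H (t₀ + 1)) y).toReal) := by gcongr
      _ = _ := by ring
  · exact (integrableOn_weight_geomSum hq h1 h2).const_mul _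
  · filter_upwards [ae_restrict_of_ae (ae_good hq)] with y hy
    have hc : Tendsto (fun t => sol q H t y) (𝓝[Ici 0] t₀) (𝓝 (sol q H t₀ y)) :=
      (hasDerivWithinAt_sol hy hH ht₀).continuousWithinAt
    have := ((hc.sub_const (sol q H t₀ y)).abs).const_mul (weight y)
    simpa using this

lemma isSolution_sol (hq : IsDensity q) (hH : 0 < H) {fin : ℝ × ℝ → ℝ}
    (hfin : ∀ y ∈ Y, (q y).toReal / H = fin y) : IsSolution (fun _ _ => 1) fin (sol q H) where
  nonneg _ _ _ _ := sol_nonneg hH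
  integrable t ht := by
    refine ((integrableOn_weight_geomSum hq (ratio_nonneg hH ht) (ratio_lt_one hH ht)).const_mul
      (H / (H + t / 2) ^ 2)).congr (ae_of_all _ fun y => ?_)
    simp only [sol]; ring
  continuous_L1 _ ht := tendsto_weighted_sol hq hH ht
  initial y hy := by rw [sol_zero hH, hfin y hy]
  equation := by
    filter_upwards [ae_restrict_of_ae (ae_good hq)] with y hy t ht
    exact solvesAt_sol hq hH ht hy

end

/-! ### The Fourier–Laplace transform of the series, and injectivity -/

section

/-- The kernel of the Fourier–Laplace transform. -/
noncomputable def chr (ζ : ℂ) (ξ : ℝ) (y : ℝ × ℝ) : ℂ :=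
  Complex.exp (-((y.1 : ℂ) * ζ)) * Complex.exp (-(Complex.I * (y.2 : ℂ) * (ξ : ℂ)))

@[fun_prop]
lemma continuous_chr (ζ : ℂ) (ξ : ℝ) : Continuous (chr ζ ξ) := by unfold chr; fun_prop

lemma chr_add (ζ : ℂ) (ξ : ℝ) (y z : ℝ × ℝ) : chr ζ ξ (y + z) = chr ζ ξ y * chr ζ ξ z := by
  simp only [chr, ← Complex.exp_add]
  congr 1
  push_cast [Prod.fst_add, Prod.snd_add]
  ring

lemma chr_zero_zero (y : ℝ × ℝ) : chr 0 0 y = 1 := by simp [chr]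

lemma norm_chr_le {ζ : ℂ} (hζ : 0 ≤ ζ.re) (ξ : ℝ) {y : ℝ × ℝ} (hy : y ∈ Y) :
    ‖chr ζ ξ y‖ ≤ 1 := by
  have := mem_Y.1 hy
  rw [chr, norm_mul, Complex.norm_exp, Complex.norm_exp]
  have e : (-(Complex.I * (y.2 : ℂ) * (ξ : ℂ))).re = 0 := by simp
  rw [e, Real.exp_zero, mul_one, Real.exp_le_one_iff]
  simp only [Complex.neg_re, Complex.re_ofReal_mul, Left.neg_nonpos_iff]
  positivity

lemma fourierLaplace_eq (g : ℝ × ℝ → ℝ) (ζ : ℂ) (ξ : ℝ) :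
    fourierLaplace g ζ ξ = ∫ y in Y, chr ζ ξ y * (g y : ℂ) := rfl

lemma integrableOn_chr_mul {g : ℝ × ℝ → ℝ} (hg : IntegrableOn g Y) {ζ : ℂ} (hζ : 0 ≤ ζ.re)
    (ξ : ℝ) : IntegrableOn (fun y => chr ζ ξ y * (g y : ℂ)) Y := by
  refine Integrable.bdd_mul (c := 1) hg.ofReal (continuous_chr ζ ξ).aestronglyMeasurable ?_
  filter_upwards [ae_restrict_mem measurableSet_Y] with y hy using norm_chr_le hζ ξ hy

lemma norm_fourierLaplace_le {g : ℝ × ℝ → ℝ} (hg : IntegrableOn g Y) (hg0 : ∀ y ∈ Y, 0 ≤ g y)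
    {ζ : ℂ} (hζ : 0 ≤ ζ.re) (ξ : ℝ) : ‖fourierLaplace g ζ ξ‖ ≤ ∫ y in Y, g y := by
  rw [fourierLaplace_eq]
  refine norm_integral_le_of_norm_le hg ?_
  filter_upwards [ae_restrict_mem measurableSet_Y] with y hy
  rw [norm_mul, Complex.norm_real, Real.norm_of_nonneg (hg0 y hy)]
  exact mul_le_of_le_one_left (hg0 y hy) (norm_chr_le hζ ξ hy)

variable {q : ℝ × ℝ → ℝ≥0∞}

lemma integrable_chr_convMeasure (hq : IsDensity q) (n : ℕ) {ζ : ℂ} (hζ : 0 ≤ ζ.re) (ξ : ℝ) :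
    Integrable (chr ζ ξ) (convMeasure q n) := by
  have := isProbabilityMeasure_convMeasure hq n
  refine Integrable.of_bound (continuous_chr ζ ξ).aestronglyMeasurable 1 ?_
  filter_upwards [ae_convMeasure_mem_Y hq n] with y hy using norm_chr_le hζ ξ hy

lemma integral_chr_convMeasure (hq : IsDensity q) (n : ℕ) {ζ : ℂ} (hζ : 0 ≤ ζ.re) (ξ : ℝ) :
    ∫ y, chr ζ ξ y ∂(convMeasure q n) = (∫ y, chr ζ ξ y ∂(convMeasure q 0)) ^ (n + 1) := by
  induction n with
  | zero => simp
  | succ n ih =>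
    have := isProbabilityMeasure_convMeasure hq n
    have := isProbabilityMeasure_convMeasure hq 0
    have hi := integrable_chr_convMeasure hq (n + 1) hζ ξ
    rw [convMeasure_succ hq.aemeasurable] at hi ⊢
    rw [integral_conv hi]
    simp_rw [chr_add, integral_const_mul, integral_mul_const, ih]
    ring

lemma ae_convPow_lt_top (hq : IsDensity q) (n : ℕ) : ∀ᵐ y, convPow q n y < ∞ := by
  filter_upwards [ae_good hq] with y hy using (hy.convPow_ne_top n).lt_top

lemma fourierLaplace_convPow (hq : IsDensity q) (n : ℕ) (ζ : ℂ) (ξ : ℝ) :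
    fourierLaplace (fun y => (convPow q n y).toReal) ζ ξ =
      ∫ y, chr ζ ξ y ∂(convMeasure q n) := by
  rw [fourierLaplace_eq, setIntegral_eq_integral_of_forall_compl_eq_zero, convMeasure,
    integral_withDensity_eq_integral_toReal_smul₀ (aemeasurable_convPow hq.aemeasurable n)
      (ae_convPow_lt_top hq n)]
  · refine integral_congr_ae (ae_of_all _ fun y => ?_)
    simp [mul_comm]
  · intro y hy
    simp [convPow_eq_zero hq.eq_zero n y hy]

lemma fourierLaplace_const_mul (c : ℝ) (g : ℝ × ℝ → ℝ) (ζ : ℂ) (ξ : ℝ) :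
    fourierLaplace (fun y => c * g y) ζ ξ = c * fourierLaplace g ζ ξ := by
  rw [fourierLaplace_eq, fourierLaplace_eq, ← integral_const_mul]
  refine integral_congr_ae (ae_of_all _ fun y => ?_)
  simp; ring

lemma integrable_convPow_toReal (hq : IsDensity q) (n : ℕ) :
    Integrable fun y => (convPow q n y).toReal :=
  integrable_toReal_of_lintegral_ne_top (aemeasurable_convPow hq.aemeasurable n)
    (by simp [lintegral_convPow hq])

/-- The transform of q^{*(n+1)} is φ^{n+1}, leaving the geometric series φ ∑ (xφ)ⁿ with |φ| ≤ 1. Sum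
and integral may be exchanged because the n-th term has L¹ norm at most xⁿ. -/
lemma fourierLaplace_geomSum (hq : IsDensity q) {x : ℝ} (hx : 0 ≤ x) (hx1 : x < 1) {ζ : ℂ}
    (hζ : 0 ≤ ζ.re) (ξ : ℝ) :
    fourierLaplace (fun y => (geomSum q x y).toReal) ζ ξ =
      (∫ y, chr ζ ξ y ∂(convMeasure q 0)) / (1 - x * ∫ y, chr ζ ξ y ∂(convMeasure q 0)) := by
  set φ := ∫ y, chr ζ ξ y ∂(convMeasure q 0) with hφ
  have hφ1 : ‖φ‖ ≤ 1 := by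
    have := isProbabilityMeasure_convMeasure hq 0
    refine (norm_integral_le_of_norm_le_const (C := 1) ?_).trans (by simp)
    filter_upwards [ae_convMeasure_mem_Y hq 0] with y hy using norm_chr_le hζ ξ hy
  have hint : ∀ n, Integrable (fun y => (x ^ n * (convPow q n y).toReal)) (volume.restrict Y) :=
    fun n => ((integrable_convPow_toReal hq n).const_mul _).restrict
  have h1 : HasSum
      (fun n => ∫ y in Y, chr ζ ξ y * ((x ^ n * (convPow q n y).toReal : ℝ) : ℂ))
      (∫ y in Y, ∑' n, chr ζ ξ y * ((x ^ n * (convPow q n y).toReal : ℝ) : ℂ)) := by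
    refine hasSum_integral_of_summable_integral_norm
      (fun n => integrableOn_chr_mul (hint n) hζ ξ) ?_
    refine Summable.of_nonneg_of_le (fun n => by positivity) (fun n => ?_)
      (summable_geometric_of_lt_one hx hx1)
    calc ∫ y in Y, ‖chr ζ ξ y * ((x ^ n * (convPow q n y).toReal : ℝ) : ℂ)‖
        ≤ ∫ y in Y, x ^ n * (convPow q n y).toReal := by
          refine integral_mono_ae (integrableOn_chr_mul (hint n) hζ ξ).norm (hint n) ?_
          filter_upwards [ae_restrict_mem measurableSet_Y] with y hy
          have : 0 ≤ x ^ n * (convPow q n y).toReal := by positivity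
          rw [norm_mul, Complex.norm_real, Real.norm_of_nonneg this]
          exact mul_le_of_le_one_left this (norm_chr_le hζ ξ hy)
      _ = x ^ n := by
          rw [integral_const_mul, setIntegral_eq_integral_of_forall_compl_eq_zero fun y hy => by
            simp [convPow_eq_zero hq.eq_zero n y hy], integral_toReal
              (aemeasurable_convPow hq.aemeasurable n) (ae_convPow_lt_top hq n),
            lintegral_convPow hq]
          simp
  have h2 : fourierLaplace (fun y => (geomSum q x y).toReal) ζ ξ =
      ∫ y in Y, ∑' n, chr ζ ξ y * ((x ^ n * (convPow q n y).toReal : ℝ) : ℂ) := by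
    rw [fourierLaplace_eq]
    refine integral_congr_ae ?_
    filter_upwards [ae_restrict_of_ae (ae_good hq)] with y hy
    rw [tsum_mul_left, geomSum_toReal hy hx, Complex.ofReal_tsum]
  have h3 : ∀ n, ∫ y in Y, chr ζ ξ y * ((x ^ n * (convPow q n y).toReal : ℝ) : ℂ) =
      φ * (x * φ) ^ n := fun n => by
    have := fourierLaplace_const_mul (x ^ n) (fun y => (convPow q n y).toReal) ζ ξ
    rw [fourierLaplace_eq, fourierLaplace_convPow hq, integral_chr_convMeasure hq n hζ] at this
    rw [this, ← hφ]
    push_cast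
    ring
  simp_rw [h3] at h1
  have h4 : HasSum (fun n => φ * (x * φ) ^ n) (φ * (1 - x * φ)⁻¹) := by
    refine (hasSum_geometric_of_norm_lt_one ?_).mul_left φ
    rw [norm_mul, Complex.norm_real, Real.norm_of_nonneg hx]
    calc x * ‖φ‖ ≤ x * 1 := by gcongr
      _ < 1 := by linarith
  rw [h2, h1.unique h4, div_eq_mul_inv]

/-- The positive and negative parts of the difference are densities of two finite measures.
Vanishing of the transform on the imaginary axis says that these have the same characteristic
function, so they coincide and the difference is zero. -/
lemma ae_eq_of_fourierLaplace_eq {g g' : ℝ × ℝ → ℝ} (hg : IntegrableOn g Y)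
    (hg' : IntegrableOn g' Y)
    (h : ∀ η ξ : ℝ, fourierLaplace g' (Complex.I * η) ξ = fourierLaplace g (Complex.I * η) ξ) :
    g' =ᵐ[volume.restrict Y] g := by
  set d : ℝ × ℝ → ℝ := fun y => g' y - g y with hd
  have hdi : Integrable d (volume.restrict Y) := hg'.sub hg
  have hre : ∀ η : ℝ, 0 ≤ (Complex.I * η).re := fun η => by simp
  have h0 : ∀ η ξ : ℝ, ∫ y in Y, chr (Complex.I * η) ξ y * (d y : ℂ) = 0 := fun η ξ => by
    have := h η ξ
    rw [fourierLaplace_eq, fourierLaplace_eq, ← sub_eq_zero,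
      ← integral_sub (integrableOn_chr_mul hg' (hre η) ξ) (integrableOn_chr_mul hg (hre η) ξ)]
      at this
    rw [← this]
    refine integral_congr_ae (ae_of_all _ fun y => ?_)
    simp [hd]; ring
  have hm : AEMeasurable (fun y => ENNReal.ofReal (d y)) (volume.restrict Y) :=
    hdi.aemeasurable.ennreal_ofReal
  have hm' : AEMeasurable (fun y => ENNReal.ofReal (-d y)) (volume.restrict Y) :=
    hdi.neg.aemeasurable.ennreal_ofReal
  have hf : ∫⁻ y in Y, ENNReal.ofReal (d y) ≠ ∞ := hdi.lintegral_lt_top.ne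
  have hf' : ∫⁻ y in Y, ENNReal.ofReal (-d y) ≠ ∞ := hdi.neg.lintegral_lt_top.ne
  have := isFiniteMeasure_withDensity hf
  have := isFiniteMeasure_withDensity hf'
  have key : (volume.restrict Y).withDensity (fun y => ENNReal.ofReal (d y)) =
      (volume.restrict Y).withDensity (fun y => ENNReal.ofReal (-d y)) := by
    refine Measure.ext_of_charFunDual (funext fun L => ?_)
    rw [charFunDual_apply, charFunDual_apply,
      integral_withDensity_eq_integral_toReal_smul₀ hm (by simp),
      integral_withDensity_eq_integral_toReal_smul₀ hm' (by simp), ← sub_eq_zero]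
    have hb : ∀ {u : ℝ × ℝ → ℝ}, Integrable u (volume.restrict Y) → Integrable
        (fun y => (ENNReal.ofReal (u y)).toReal • Complex.exp (L y * Complex.I))
        (volume.restrict Y) := fun {u} hu => by
      have h1 : Integrable (fun y => (ENNReal.ofReal (u y)).toReal) (volume.restrict Y) :=
        hu.pos_part
      refine Integrable.mono' h1 ?_ (ae_of_all _ fun y => ?_)
      · exact h1.aestronglyMeasurable.smul (Continuous.aestronglyMeasurable (by fun_prop))
      · rw [norm_smul, Complex.norm_exp_ofReal_mul_I, mul_one, Real.norm_of_nonneg]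
        exact ENNReal.toReal_nonneg
    have hn : Integrable (fun y => -d y) (volume.restrict Y) := hdi.neg
    -- The frequencies change sign because `chr` uses e^{-i·} while the characteristic function uses
    -- e^{+i·}.
    rw [← integral_sub (hb hdi) (hb hn), ← h0 (-(L (1, 0))) (-(L (0, 1)))]
    refine integral_congr_ae (ae_of_all _ fun y => ?_)
    have hL : L y = y.1 * L (1, 0) + y.2 * L (0, 1) := by
      conv_lhs => rw [show y = y.1 • ((1 : ℝ), (0 : ℝ)) + y.2 • ((0 : ℝ), (1 : ℝ)) by ext <;> simp]
      rw [map_add, map_smul, map_smul, smul_eq_mul, smul_eq_mul]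
    have hs : (ENNReal.ofReal (d y)).toReal - (ENNReal.ofReal (-d y)).toReal = d y := by
      rw [ENNReal.toReal_ofReal', ENNReal.toReal_ofReal']
      rcases le_total 0 (d y) with h | h
      · rw [max_eq_left h, max_eq_right (by linarith)]; ring
      · rw [max_eq_right h, max_eq_left (by linarith)]; ring
    beta_reduce
    rw [← sub_smul, hs, hL, chr, ← Complex.exp_add, Complex.real_smul, mul_comm]
    congr 2
    push_cast
    ring
  have h2 := (withDensity_eq_iff hm hm' hf).1 key
  filter_upwards [h2] with y hy
  have : d y = 0 := by
    rcases le_total 0 (d y) with h | h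
    · rw [ENNReal.ofReal_of_nonpos (by linarith : -d y ≤ 0), ENNReal.ofReal_eq_zero] at hy
      linarith
    · rw [ENNReal.ofReal_of_nonpos h, eq_comm, ENNReal.ofReal_eq_zero] at hy
      linarith
  exact sub_eq_zero.1 this

end

/-! ### Bounded continuous data: every point is good -/

section Classical

variable {q : ℝ × ℝ → ℝ≥0∞} {K : ℝ≥0∞}

/-- Convolving with a probability density does not increase the supremum. The bound is uniform in n,
so the series is dominated by a geometric one at every point. -/
lemma convPow_le (hq : IsDensity q) (hK : ∀ y, q y ≤ K) (n : ℕ) : ∀ y, convPow q n y ≤ K := by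
  induction n with
  | zero => exact hK
  | succ n ih =>
    intro y
    calc ∫⁻ z, q z * convPow q n (-z + y) ≤ ∫⁻ z, q z * K := by
          gcongr with z
          exact ih _
      _ = K := by rw [lintegral_mul_const'' _ hq.aemeasurable, hq.lintegral_eq_one, one_mul]

lemma good_of_le (hq : IsDensity q) (hK : ∀ y, q y ≤ K) (hKtop : K ≠ ∞) (y : ℝ × ℝ) :
    Good q y := by
  intro x _ hx1
  calc geomSum q x y ≤ ∑' n : ℕ, ENNReal.ofReal x ^ n * K := by
        unfold geomSum
        gcongr with n
        exact convPow_le hq hK n y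
    _ < ∞ := by
        rw [ENNReal.tsum_mul_right, ENNReal.tsum_geometric]
        refine ENNReal.mul_lt_top ?_ hKtop.lt_top
        rw [lt_top_iff_ne_top, ENNReal.inv_ne_top, ← pos_iff_ne_zero, tsub_pos_iff_lt]
        exact ENNReal.ofReal_lt_one.2 hx1

lemma ae_fst_ne (a : ℝ) : ∀ᵐ z : ℝ × ℝ, z.1 ≠ a := by
  have : {z : ℝ × ℝ | ¬ z.1 ≠ a} = {a} ×ˢ univ := by ext; simp
  rw [ae_iff, this, Measure.volume_eq_prod, Measure.prod_prod]
  simp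

/-- The extension by zero may jump across m = 0, so the integrand may be discontinuous in y at y₀
only for z on the line z.1 = y₀.1. That line is null, and dominated convergence applies: for z.1 <
y₀.1 the shifted point stays in Y, for z.1 > y₀.1 the integrand vanishes near y₀. -/
lemma continuousOn_convPow (hq : IsDensity q) (hK : ∀ y, q y ≤ K) (hKtop : K ≠ ∞)
    (hc : ContinuousOn (fun y => (q y).toReal) Y) (n : ℕ) :
    ContinuousOn (fun y => (convPow q n y).toReal) Y := by
  induction n with
  | zero => exact hc
  | succ n ih =>
    have hle := convPow_le hq hK n
    have hr : ∀ y, AEMeasurable (fun z => convPow q n (-z + y)) volume := fun y =>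
      (aemeasurable_convPow hq.aemeasurable n).comp_quasiMeasurePreserving
        (((measurePreserving_add_right volume y).comp
          (Measure.measurePreserving_neg volume)).quasiMeasurePreserving)
    have hqtop : ∀ z, q z < ∞ := fun z => (hK z).trans_lt hKtop.lt_top
    have e : ∀ y, (convPow q (n + 1) y).toReal =
        ∫ z, (q z).toReal * (convPow q n (-z + y)).toReal := fun y => by
      simp_rw [← ENNReal.toReal_mul]
      have hm : AEMeasurable (fun z => q z * convPow q n (-z + y)) volume :=
        hq.aemeasurable.mul (hr y)
      rw [integral_toReal hm (ae_of_all _ fun z => ENNReal.mul_lt_top (hqtop z)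
        ((hle _).trans_lt hKtop.lt_top))]
      rfl
    simp_rw [e]
    intro y₀ _
    refine ContinuousAt.continuousWithinAt ?_
    refine continuousAt_of_dominated (bound := fun z => (q z).toReal * K.toReal) ?_ ?_ ?_ ?_
    · refine Eventually.of_forall fun y => ?_
      exact (hq.aemeasurable.ennreal_toReal.mul (hr y).ennreal_toReal).aestronglyMeasurable
    · refine Eventually.of_forall fun y => ae_of_all _ fun z => ?_
      rw [Real.norm_of_nonneg (by positivity)]
      gcongr
      exact hle _
    · exact (integrable_convPow_toReal hq 0).mul_const _
    · filter_upwards [ae_fst_ne y₀.1] with z hz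
      refine continuousAt_const.mul ?_
      have hcont : ContinuousAt (fun y : ℝ × ℝ => -z + y) y₀ := by fun_prop
      rcases lt_or_gt_of_ne hz with h | h
      · refine ContinuousAt.comp (f := fun y : ℝ × ℝ => -z + y)
          (g := fun y => (convPow q n y).toReal) ?_ hcont
        refine ih.continuousAt (isOpen_Y.mem_nhds ?_)
        rw [mem_Y]; simpa using h
      · have hev : ∀ᶠ y in 𝓝 y₀, (convPow q n (-z + y)).toReal = 0 := by
          have : ∀ᶠ y : ℝ × ℝ in 𝓝 y₀, y.1 < z.1 :=
            continuous_fst.continuousAt.eventually_lt continuousAt_const h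
          filter_upwards [this] with y hy
          rw [convPow_eq_zero hq.eq_zero, ENNReal.toReal_zero]
          rw [mem_Y]
          simp only [Prod.fst_add, Prod.fst_neg, not_lt]
          linarith
        exact (continuousAt_const (y := (0 : ℝ))).congr (hev.mono fun _ h => h.symm)

lemma continuousOn_sol (hq : IsDensity q) (hK : ∀ y, q y ≤ K) (hKtop : K ≠ ∞)
    (hc : ContinuousOn (fun y => (q y).toReal) Y) {H t : ℝ} (hH : 0 < H) (ht : 0 ≤ t) :
    ContinuousOn (sol q H t) Y := by
  have hx := ratio_nonneg hH ht
  have hx1 := ratio_lt_one hH ht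
  refine continuousOn_const.mul ?_
  have : (fun y => (geomSum q (ratio H t) y).toReal) =
      fun y => ∑' n, ratio H t ^ n * (convPow q n y).toReal :=
    funext fun y => geomSum_toReal (good_of_le hq hK hKtop y) hx
  rw [this]
  refine continuousOn_tsum (u := fun n => ratio H t ^ n * K.toReal)
    (fun n => continuousOn_const.mul (continuousOn_convPow hq hK hKtop hc n))
    ((summable_geometric_of_lt_one hx hx1).mul_right _) fun n y _ => ?_
  rw [Real.norm_of_nonneg (by positivity)]
  gcongr
  exact convPow_le hq hK n y

end Classical

/-! ### The normalised datum and the explicit transform -/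

section InitialDatum

variable {fin : ℝ × ℝ → ℝ}

/-- The initial datum, extended by zero and normalised to be a probability density. -/
noncomputable def initialDensity (fin : ℝ × ℝ → ℝ) : ℝ × ℝ → ℝ≥0∞ :=
  Y.indicator fun y => ENNReal.ofReal (H₀ fin * fin y)

lemma moment_zero_zero (g : ℝ × ℝ → ℝ) : moment 0 0 g = ∫ y in Y, g y := by simp [moment]

lemma H₀_pos (hpos : 0 < moment 0 0 fin) : 0 < H₀ fin := inv_pos.2 hpos

lemma integral_eq_inv_H₀ : ∫ y in Y, fin y = 1 / H₀ fin := by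
  rw [← moment_zero_zero, H₀, one_div, inv_inv]

lemma integrableOn_of_weight (hdecay : IntegrableOn (fun y => weight y * fin y) Y)
    {u : ℝ × ℝ → ℝ} (hu : Continuous u) (hle : ∀ y ∈ Y, |u y| ≤ weight y) :
    IntegrableOn (fun y => u y * fin y) Y := by
  have hw : AEStronglyMeasurable (fun y : ℝ × ℝ => u y / weight y) (volume.restrict Y) :=
    (hu.measurable.div continuous_weight.measurable).aestronglyMeasurable
  refine (Integrable.bdd_mul (c := 1) hdecay hw ?_).congr ?_
  · filter_upwards [ae_restrict_mem measurableSet_Y] with y hy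
    have := one_le_weight hy
    rw [norm_div, Real.norm_of_nonneg (by linarith : 0 ≤ weight y)]
    exact div_le_one_of_le₀ (hle y hy) (by linarith)
  · filter_upwards [ae_restrict_mem measurableSet_Y] with y hy
    have := one_le_weight hy
    field_simp

lemma integrableOn_fin (hdecay : IntegrableOn (fun y => weight y * fin y) Y) :
    IntegrableOn fin Y := by
  have := integrableOn_of_weight hdecay (u := fun _ => 1) continuous_const
    (fun y hy => by simpa using one_le_weight hy)
  simpa using this

lemma initialDensity_toReal (hnonneg : ∀ y ∈ Y, 0 ≤ fin y) (hpos : 0 < moment 0 0 fin)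
    {y : ℝ × ℝ} (hy : y ∈ Y) : (initialDensity fin y).toReal = H₀ fin * fin y := by
  rw [initialDensity, indicator_of_mem hy,
    ENNReal.toReal_ofReal (mul_nonneg (H₀_pos hpos).le (hnonneg y hy))]

lemma isDensity_initialDensity (hnonneg : ∀ y ∈ Y, 0 ≤ fin y)
    (hdecay : IntegrableOn (fun y => weight y * fin y) Y) (hpos : 0 < moment 0 0 fin) :
    IsDensity (initialDensity fin) where
  aemeasurable := by
    rw [initialDensity, aemeasurable_indicator_iff measurableSet_Y]
    exact ((integrableOn_fin hdecay).aemeasurable.const_mul _).ennreal_ofReal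
  eq_zero y hy := indicator_of_notMem hy _
  lintegral_eq_one := by
    have hH := H₀_pos hpos
    rw [initialDensity, lintegral_indicator measurableSet_Y,
      ← ofReal_integral_eq_lintegral_ofReal ((integrableOn_fin hdecay).const_mul _),
      integral_const_mul, integral_eq_inv_H₀]
    · rw [mul_one_div_cancel hH.ne']; simp
    · filter_upwards [ae_restrict_mem measurableSet_Y] with y hy
      exact mul_nonneg hH.le (hnonneg y hy)
  weight_lt_top := by
    have e : (fun y => ENNReal.ofReal (weight y) * initialDensity fin y) =
        Y.indicator fun y => ENNReal.ofReal (H₀ fin * (weight y * fin y)) := by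
      ext y
      by_cases hy : y ∈ Y
      · have := one_le_weight hy
        rw [initialDensity, indicator_of_mem hy, indicator_of_mem hy,
          ← ENNReal.ofReal_mul (by linarith)]
        congr 1; ring
      · simp [initialDensity, hy]
    rw [e, lintegral_indicator measurableSet_Y]
    exact (hdecay.const_mul _).lintegral_lt_top

lemma integral_convMeasure_initialDensity (hnonneg : ∀ y ∈ Y, 0 ≤ fin y)
    (hdecay : IntegrableOn (fun y => weight y * fin y) Y) (hpos : 0 < moment 0 0 fin)
    {E : Type*} [NormedAddCommGroup E] [NormedSpace ℝ E] (g : ℝ × ℝ → E) :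
    ∫ y, g y ∂(convMeasure (initialDensity fin) 0) = H₀ fin • ∫ y in Y, fin y • g y := by
  have hq := isDensity_initialDensity hnonneg hdecay hpos
  rw [convMeasure, convPow, integral_withDensity_eq_integral_toReal_smul₀ hq.aemeasurable
    (ae_convPow_lt_top hq 0), ← integral_smul,
    ← setIntegral_eq_integral_of_forall_compl_eq_zero (s := Y)]
  · refine setIntegral_congr_fun measurableSet_Y fun y hy => ?_
    rw [initialDensity_toReal hnonneg hpos hy, mul_smul]
  · intro y hy; simp [hq.eq_zero y hy]

lemma integral_chr_initialDensity (hnonneg : ∀ y ∈ Y, 0 ≤ fin y)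
    (hdecay : IntegrableOn (fun y => weight y * fin y) Y) (hpos : 0 < moment 0 0 fin)
    (ζ : ℂ) (ξ : ℝ) :
    ∫ y, chr ζ ξ y ∂(convMeasure (initialDensity fin) 0) = H₀ fin * fourierLaplace fin ζ ξ := by
  rw [integral_convMeasure_initialDensity hnonneg hdecay hpos, Complex.real_smul]
  congr 1
  refine integral_congr_ae (ae_of_all _ fun y => ?_)
  simp only [Complex.real_smul]
  rw [mul_comm]; rfl

lemma norm_H₀_mul_fourierLaplace_le (hnonneg : ∀ y ∈ Y, 0 ≤ fin y)
    (hdecay : IntegrableOn (fun y => weight y * fin y) Y) (hpos : 0 < moment 0 0 fin)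
    {ζ : ℂ} (hζ : 0 ≤ ζ.re) (ξ : ℝ) : ‖(H₀ fin : ℂ) * fourierLaplace fin ζ ξ‖ ≤ 1 := by
  have hH := H₀_pos hpos
  have h := norm_fourierLaplace_le (integrableOn_fin hdecay) hnonneg hζ ξ
  rw [integral_eq_inv_H₀] at h
  rw [norm_mul, Complex.norm_real, Real.norm_of_nonneg hH.le]
  calc H₀ fin * ‖fourierLaplace fin ζ ξ‖ ≤ H₀ fin * (1 / H₀ fin) := by gcongr
    _ = 1 := by field_simp

lemma fourierLaplace_zero_zero : fourierLaplace fin 0 0 = ((1 / H₀ fin : ℝ) : ℂ) := by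
  rw [fourierLaplace_eq, ← integral_eq_inv_H₀, ← integral_complex_ofReal]
  simp [chr_zero_zero]

/-- |φ t/2| ≤ t/2 < H + t/2. -/
lemma explicitF_denom_ne_zero {H t : ℝ} (hH : 0 < H) (ht : 0 ≤ t) {φ : ℂ} (hφ : ‖φ‖ ≤ 1) :
    (H : ℂ) + t / 2 - φ * (t / 2) ≠ 0 := by
  intro h
  have h1 : (H : ℂ) + t / 2 = φ * (t / 2) := sub_eq_zero.1 h
  have h2 : ‖(H : ℂ) + t / 2‖ = H + t / 2 := by
    rw [show (H : ℂ) + t / 2 = ((H + t / 2 : ℝ) : ℂ) by push_cast; rfl, Complex.norm_real,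
      Real.norm_of_nonneg (by positivity)]
  have h3 : ‖φ * ((t : ℂ) / 2)‖ ≤ 1 * (t / 2) := by
    rw [norm_mul, show (t : ℂ) / 2 = ((t / 2 : ℝ) : ℂ) by push_cast; rfl, Complex.norm_real,
      Real.norm_of_nonneg (by positivity)]
    gcongr
  rw [← h1, h2] at h3
  linarith

lemma add_half_ne_zero {H t : ℝ} (hH : 0 < H) (ht : 0 ≤ t) : (H : ℂ) + t / 2 ≠ 0 := by
  have : ((H + t / 2 : ℝ) : ℂ) ≠ 0 := Complex.ofReal_ne_zero.2 (by positivity)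
  simpa using this

lemma denomFactor_eq (hpos : 0 < moment 0 0 fin) {t : ℝ} (ht : 0 ≤ t) {ζ : ℂ} {ξ : ℝ}
    (hF : fourierLaplace fin ζ ξ ≠ 0) :
    denomFactor fin t ζ ξ =
      ((H₀ fin : ℂ) + t / 2 - (H₀ fin * fourierLaplace fin ζ ξ) * (t / 2)) /
        (((H₀ fin : ℂ) + t / 2) * fourierLaplace fin ζ ξ) := by
  have hs := add_half_ne_zero (H₀_pos hpos) ht
  unfold denomFactor
  push_cast
  rw [div_sub_div _ _ hF hs]
  congr 1 <;> ring

lemma denomFactor_ne_zero (hnonneg : ∀ y ∈ Y, 0 ≤ fin y)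
    (hdecay : IntegrableOn (fun y => weight y * fin y) Y) (hpos : 0 < moment 0 0 fin)
    {t : ℝ} (ht : 0 ≤ t) {ζ : ℂ} (hζ : 0 ≤ ζ.re) {ξ : ℝ} (hF : fourierLaplace fin ζ ξ ≠ 0) :
    denomFactor fin t ζ ξ ≠ 0 := by
  rw [denomFactor_eq hpos ht hF]
  exact div_ne_zero (explicitF_denom_ne_zero (H₀_pos hpos) ht
    (norm_H₀_mul_fourierLaplace_le hnonneg hdecay hpos hζ ξ))
    (mul_ne_zero (add_half_ne_zero (H₀_pos hpos) ht) hF)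

/-- A form without 1/F(0), valid also where F(0) = 0 and smooth in t; the Bernoulli equation and the
comparison with `sol` are checked on it without case distinction. -/
lemma explicitF_eq (hnonneg : ∀ y ∈ Y, 0 ≤ fin y)
    (hdecay : IntegrableOn (fun y => weight y * fin y) Y) (hpos : 0 < moment 0 0 fin)
    {t : ℝ} (ht : 0 ≤ t) {ζ : ℂ} (hζ : 0 ≤ ζ.re) (ξ : ℝ) :
    explicitF fin t ζ ξ = (H₀ fin : ℂ) * (H₀ fin * fourierLaplace fin ζ ξ) /
      (((H₀ fin : ℂ) + t / 2) *
        ((H₀ fin : ℂ) + t / 2 - (H₀ fin * fourierLaplace fin ζ ξ) * (t / 2))) := by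
  have hs := add_half_ne_zero (H₀_pos hpos) ht
  have hd := explicitF_denom_ne_zero (H₀_pos hpos) ht
    (norm_H₀_mul_fourierLaplace_le hnonneg hdecay hpos hζ ξ)
  unfold explicitF
  split_ifs with hF
  · simp [hF]
  · rw [denomFactor_eq hpos ht hF]
    push_cast
    field_simp

lemma explicitF_zero_time (hnonneg : ∀ y ∈ Y, 0 ≤ fin y)
    (hdecay : IntegrableOn (fun y => weight y * fin y) Y) (hpos : 0 < moment 0 0 fin)
    {ζ : ℂ} (hζ : 0 ≤ ζ.re) (ξ : ℝ) : explicitF fin 0 ζ ξ = fourierLaplace fin ζ ξ := by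
  have hH : (H₀ fin : ℂ) ≠ 0 := Complex.ofReal_ne_zero.2 (H₀_pos hpos).ne'
  rw [explicitF_eq hnonneg hdecay hpos le_rfl hζ]
  simp
  field_simp

lemma explicitF_zero_zero (hnonneg : ∀ y ∈ Y, 0 ≤ fin y)
    (hdecay : IntegrableOn (fun y => weight y * fin y) Y) (hpos : 0 < moment 0 0 fin)
    {t : ℝ} (ht : 0 ≤ t) : explicitF fin t 0 0 = ((1 / (H₀ fin + t / 2) : ℝ) : ℂ) := by
  have hH : (H₀ fin : ℂ) ≠ 0 := Complex.ofReal_ne_zero.2 (H₀_pos hpos).ne'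
  have hs := add_half_ne_zero (H₀_pos hpos) ht
  rw [explicitF_eq hnonneg hdecay hpos ht (by simp), fourierLaplace_zero_zero]
  push_cast
  rw [mul_one_div_cancel hH, mul_one, one_mul, add_sub_cancel_right]
  field_simp

lemma hasDerivWithinAt_explicitF (hnonneg : ∀ y ∈ Y, 0 ≤ fin y)
    (hdecay : IntegrableOn (fun y => weight y * fin y) Y) (hpos : 0 < moment 0 0 fin)
    {t : ℝ} (ht : 0 ≤ t) {ζ : ℂ} (hζ : 0 ≤ ζ.re) (ξ : ℝ) :
    HasDerivWithinAt (fun s : ℝ => explicitF fin s ζ ξ)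
      ((1 / 2 : ℂ) * explicitF fin t ζ ξ ^ 2 - explicitF fin t 0 0 * explicitF fin t ζ ξ)
      (Ici 0) t := by
  have hs := add_half_ne_zero (H₀_pos hpos) ht
  have hd := explicitF_denom_ne_zero (H₀_pos hpos) ht
    (norm_H₀_mul_fourierLaplace_le hnonneg hdecay hpos hζ ξ)
  rw [explicitF_zero_zero hnonneg hdecay hpos ht, explicitF_eq hnonneg hdecay hpos ht hζ]
  set φ := (H₀ fin : ℂ) * fourierLaplace fin ζ ξ with hφ
  set H := H₀ fin
  have d0 : HasDerivAt (fun s : ℝ => (s : ℂ) / 2) (1 / 2) t := by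
    simpa using (hasDerivAt_id t).ofReal_comp.div_const 2
  have d1 : HasDerivAt (fun s : ℝ => (H : ℂ) + s / 2) (1 / 2) t := d0.const_add _
  have d2 : HasDerivAt (fun s : ℝ => (H : ℂ) + s / 2 - φ * (s / 2)) (1 / 2 - φ * (1 / 2)) t :=
    d1.sub (d0.const_mul φ)
  have d3 : HasDerivAt (fun s : ℝ => (H : ℂ) * φ / (((H : ℂ) + s / 2) *
      ((H : ℂ) + s / 2 - φ * (s / 2)))) _ t :=
    (hasDerivAt_const t ((H : ℂ) * φ)).div (d1.mul d2) (mul_ne_zero hs hd)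
  refine ((d3.hasDerivWithinAt (s := Ici 0)).congr
    (fun s hs => explicitF_eq hnonneg hdecay hpos hs hζ ξ)
    (explicitF_eq hnonneg hdecay hpos ht hζ ξ)).congr_deriv ?_
  push_cast
  generalize (t : ℂ) / 2 = τ at *
  field_simp
  ring

lemma fourierLaplace_sol (hnonneg : ∀ y ∈ Y, 0 ≤ fin y)
    (hdecay : IntegrableOn (fun y => weight y * fin y) Y) (hpos : 0 < moment 0 0 fin)
    {t : ℝ} (ht : 0 ≤ t) {ζ : ℂ} (hζ : 0 ≤ ζ.re) (ξ : ℝ) :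
    fourierLaplace (sol (initialDensity fin) (H₀ fin) t) ζ ξ = explicitF fin t ζ ξ := by
  have hH := H₀_pos hpos
  have hs := add_half_ne_zero hH ht
  have hd := explicitF_denom_ne_zero hH ht
    (norm_H₀_mul_fourierLaplace_le hnonneg hdecay hpos hζ ξ)
  unfold sol
  rw [fourierLaplace_const_mul, fourierLaplace_geomSum
    (isDensity_initialDensity hnonneg hdecay hpos) (ratio_nonneg hH ht) (ratio_lt_one hH ht) hζ,
    integral_chr_initialDensity hnonneg hdecay hpos, explicitF_eq hnonneg hdecay hpos ht hζ]
  set φ := (H₀ fin : ℂ) * fourierLaplace fin ζ ξ with hφ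
  have e : (1 : ℂ) - (ratio (H₀ fin) t : ℝ) * φ =
      ((H₀ fin : ℂ) + t / 2 - φ * (t / 2)) / ((H₀ fin : ℂ) + t / 2) := by
    unfold ratio
    push_cast
    rw [eq_div_iff hs, sub_mul, div_mul_eq_mul_div, div_mul_cancel₀ _ hs]
    ring
  rw [e]
  push_cast
  field_simp

lemma isInverseFourierLaplace_sol (hnonneg : ∀ y ∈ Y, 0 ≤ fin y)
    (hdecay : IntegrableOn (fun y => weight y * fin y) Y) (hpos : 0 < moment 0 0 fin)
    {t : ℝ} (ht : 0 ≤ t) :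
    IsInverseFourierLaplace (explicitF fin t) (sol (initialDensity fin) (H₀ fin) t) := by
  have hi := (integrable_sol (isDensity_initialDensity hnonneg hdecay hpos) (H₀_pos hpos)
    ht).integrableOn (s := Y)
  refine ⟨⟨hi, fun ζ hζ ξ => fourierLaplace_sol hnonneg hdecay hpos ht hζ ξ⟩, fun g' hg' => ?_⟩
  refine ae_eq_of_fourierLaplace_eq hi hg'.1 fun η ξ => ?_
  rw [hg'.2 _ (by simp), fourierLaplace_sol hnonneg hdecay hpos ht (by simp)]

lemma classical_sol (hnonneg : ∀ y ∈ Y, 0 ≤ fin y)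
    (hdecay : IntegrableOn (fun y => weight y * fin y) Y) (hpos : 0 < moment 0 0 fin)
    (hc : ContinuousOn fin Y) {C : ℝ} (hC : ∀ y ∈ Y, fin y ≤ C) {t : ℝ} (ht : 0 ≤ t) :
    ContinuousOn (sol (initialDensity fin) (H₀ fin) t) Y ∧
      ∀ y, SolvesAt (fun _ _ => 1) (sol (initialDensity fin) (H₀ fin)) t y := by
  have hH := H₀_pos hpos
  have hq := isDensity_initialDensity hnonneg hdecay hpos
  have hK : ∀ y, initialDensity fin y ≤ ENNReal.ofReal (H₀ fin * C) := fun y => by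
    by_cases hy : y ∈ Y
    · rw [initialDensity, indicator_of_mem hy]
      have := hC y hy
      gcongr
    · rw [hq.eq_zero y hy]; exact zero_le
  refine ⟨continuousOn_sol hq hK ENNReal.ofReal_ne_top ?_ hH ht, fun y =>
    solvesAt_sol hq hH ht (good_of_le hq hK ENNReal.ofReal_ne_top y)⟩
  exact (continuousOn_const.mul hc).congr fun y hy => initialDensity_toReal hnonneg hpos hy

end InitialDatum

/-! ### Behaviour of integrals and transforms under dilations -/

section Scaling

/-- The dilation `(m, p) ↦ (a m, b p)`. -/
noncomputable def dilation (a b : ℝ) (ha : a ≠ 0) (hb : b ≠ 0) : (ℝ × ℝ) ≃ᵐ (ℝ × ℝ) :=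
  (Homeomorph.mulLeft₀ a ha).toMeasurableEquiv.prodCongr
    (Homeomorph.mulLeft₀ b hb).toMeasurableEquiv

lemma dilation_apply {a b : ℝ} (ha : a ≠ 0) (hb : b ≠ 0) (y : ℝ × ℝ) :
    dilation a b ha hb y = (a * y.1, b * y.2) := rfl

lemma map_dilation {a b : ℝ} (ha : a ≠ 0) (hb : b ≠ 0) :
    Measure.map (dilation a b ha hb) volume =
      (ENNReal.ofReal |a⁻¹| * ENNReal.ofReal |b⁻¹|) • (volume : Measure (ℝ × ℝ)) := by
  have h : (dilation a b ha hb : ℝ × ℝ → ℝ × ℝ) = Prod.map (fun x => a * x) (fun x => b * x) := rfl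
  rw [h, Measure.volume_eq_prod, ← Measure.map_prod_map _ _ (by fun_prop) (by fun_prop),
    Real.map_volume_mul_left ha, Real.map_volume_mul_left hb, Measure.prod_smul_left,
    Measure.prod_smul_right, smul_smul]

variable {E : Type*} [NormedAddCommGroup E]

lemma integrable_comp_dilation {a b : ℝ} (ha : a ≠ 0) (hb : b ≠ 0) {h : ℝ × ℝ → E}
    (hh : Integrable h) : Integrable fun y : ℝ × ℝ => h (a * y.1, b * y.2) := by
  have : Integrable h (Measure.map (dilation a b ha hb) volume) := by
    rw [map_dilation]
    exact hh.smul_measure (ENNReal.mul_ne_top ENNReal.ofReal_ne_top ENNReal.ofReal_ne_top)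
  exact (integrable_map_equiv _ _).1 this

lemma integral_comp_dilation [NormedSpace ℝ E] {a b : ℝ} (ha : 0 < a) (hb : 0 < b)
    (h : ℝ × ℝ → E) : ∫ y in Y, h (a * y.1, b * y.2) = (a * b)⁻¹ • ∫ y in Y, h y := by
  rw [← integral_indicator measurableSet_Y, ← integral_indicator measurableSet_Y]
  have e : Y.indicator (fun y : ℝ × ℝ => h (a * y.1, b * y.2)) =
      fun y => Y.indicator h (dilation a b ha.ne' hb.ne' y) := by
    ext y
    have : dilation a b ha.ne' hb.ne' y ∈ Y ↔ y ∈ Y := by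
      rw [mem_Y, mem_Y, dilation_apply]
      exact mul_pos_iff_of_pos_left ha
    by_cases hy : y ∈ Y
    · rw [indicator_of_mem hy, indicator_of_mem (this.2 hy), dilation_apply]
    · rw [indicator_of_notMem hy, indicator_of_notMem (this.not.2 hy)]
  rw [e, ← integral_map_equiv (dilation a b ha.ne' hb.ne') (Y.indicator h), map_dilation,
    integral_smul_measure]
  congr 1
  rw [ENNReal.toReal_mul, ENNReal.toReal_ofReal (abs_nonneg _),
    ENNReal.toReal_ofReal (abs_nonneg _), abs_of_pos (inv_pos.2 ha), abs_of_pos (inv_pos.2 hb),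
    mul_inv]

lemma chr_dilation {a b : ℝ} (ha : a ≠ 0) (hb : b ≠ 0) (ζ : ℂ) (ξ : ℝ) (y : ℝ × ℝ) :
    chr (ζ / a) (ξ / b) (a * y.1, b * y.2) = chr ζ ξ y := by
  have ha' : (a : ℂ) ≠ 0 := Complex.ofReal_ne_zero.2 ha
  have hb' : (b : ℂ) ≠ 0 := Complex.ofReal_ne_zero.2 hb
  unfold chr
  push_cast
  congr 2 <;> field_simp

lemma fourierLaplace_comp_dilation {a b : ℝ} (ha : 0 < a) (hb : 0 < b) (h : ℝ × ℝ → ℝ) (ζ : ℂ)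
    (ξ : ℝ) : fourierLaplace (fun y => h (a * y.1, b * y.2)) ζ ξ =
      ((a * b)⁻¹ : ℝ) * fourierLaplace h (ζ / a) (ξ / b) := by
  rw [fourierLaplace_eq, fourierLaplace_eq, ← Complex.real_smul,
    ← integral_comp_dilation ha hb]
  simp_rw [chr_dilation ha.ne' hb.ne']

end Scaling

/-! ### Lévy's continuity theorem for densities on Y -/

section Levy

/-- The measure on the Euclidean plane with density `g` on `Y`. -/
noncomputable def planeMeasure (g : ℝ × ℝ → ℝ) : Measure (WithLp 2 (ℝ × ℝ)) :=
  ((volume.restrict Y).withDensity fun y => ENNReal.ofReal (g y)).map (WithLp.toLp 2)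

variable {g : ℝ × ℝ → ℝ}

lemma integral_planeMeasure (hg : IntegrableOn g Y) (hg0 : ∀ y ∈ Y, 0 ≤ g y)
    {E : Type*} [NormedAddCommGroup E] [NormedSpace ℝ E] [SecondCountableTopology E]
    [MeasurableSpace E] [BorelSpace E] {F : WithLp 2 (ℝ × ℝ) → E} (hF : Continuous F) :
    ∫ x, F x ∂(planeMeasure g) = ∫ y in Y, g y • F (WithLp.toLp 2 y) := by
  rw [planeMeasure, integral_map (by fun_prop) hF.measurable.aestronglyMeasurable,
    integral_withDensity_eq_integral_toReal_smul₀ hg.aemeasurable.ennreal_ofReal (by simp)]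
  refine setIntegral_congr_fun measurableSet_Y fun y hy => ?_
  rw [ENNReal.toReal_ofReal (hg0 y hy)]

lemma isProbabilityMeasure_planeMeasure (hg : IntegrableOn g Y) (hg0 : ∀ y ∈ Y, 0 ≤ g y)
    (hg1 : ∫ y in Y, g y = 1) : IsProbabilityMeasure (planeMeasure g) := by
  have : IsProbabilityMeasure ((volume.restrict Y).withDensity fun y => ENNReal.ofReal (g y)) := by
    refine ⟨?_⟩
    rw [withDensity_apply _ MeasurableSet.univ, Measure.restrict_univ,
      ← ofReal_integral_eq_lintegral_ofReal hg, hg1, ENNReal.ofReal_one]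
    filter_upwards [ae_restrict_mem measurableSet_Y] with y hy using hg0 y hy
  exact Measure.isProbabilityMeasure_map (by fun_prop)

/-- `charFun` needs an inner product, hence `WithLp 2`, as ℝ × ℝ carries the sup norm. Its
convention e^{+i⟨x, y⟩} reverses both frequencies. -/
lemma charFun_planeMeasure (hg : IntegrableOn g Y) (hg0 : ∀ y ∈ Y, 0 ≤ g y)
    (x : WithLp 2 (ℝ × ℝ)) :
    charFun (planeMeasure g) x = fourierLaplace g (Complex.I * ((-x.fst : ℝ) : ℂ)) (-x.snd) := by
  rw [charFun_apply, integral_planeMeasure hg hg0 (by fun_prop), fourierLaplace_eq]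
  refine integral_congr_ae (ae_of_all _ fun y => ?_)
  beta_reduce
  rw [Complex.real_smul, mul_comm, chr, ← Complex.exp_add, WithLp.prod_inner_apply]
  congr 2
  simp only [RCLike.inner_apply, conj_trivial]
  push_cast
  simp only [WithLp.ofLp_fst, WithLp.ofLp_snd]
  ring

/-- Convergence of the transforms on the imaginary axis of probability densities on `Y` implies
their weak convergence. -/
lemma tendsto_integral_of_tendsto_fourierLaplace {g : ℕ → ℝ × ℝ → ℝ} {G : ℝ × ℝ → ℝ}
    (hg : ∀ n, IntegrableOn (g n) Y) (hg0 : ∀ n, ∀ y ∈ Y, 0 ≤ g n y)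
    (hg1 : ∀ n, ∫ y in Y, g n y = 1) (hG : IntegrableOn G Y) (hG0 : ∀ y ∈ Y, 0 ≤ G y)
    (hG1 : ∫ y in Y, G y = 1)
    (h : ∀ η ξ : ℝ, Tendsto (fun n => fourierLaplace (g n) (Complex.I * (η : ℂ)) ξ) atTop
      (𝓝 (fourierLaplace G (Complex.I * (η : ℂ)) ξ)))
    {ψ : ℝ × ℝ → ℝ} (hψ : Continuous ψ) (hψc : HasCompactSupport ψ) :
    Tendsto (fun n => ∫ y in Y, ψ y * g n y) atTop (𝓝 (∫ y in Y, ψ y * G y)) := by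
  let μ : ℕ → ProbabilityMeasure (WithLp 2 (ℝ × ℝ)) := fun n =>
    ⟨planeMeasure (g n), isProbabilityMeasure_planeMeasure (hg n) (hg0 n) (hg1 n)⟩
  let μ₀ : ProbabilityMeasure (WithLp 2 (ℝ × ℝ)) :=
    ⟨planeMeasure G, isProbabilityMeasure_planeMeasure hG hG0 hG1⟩
  have hμ : Tendsto μ atTop (𝓝 μ₀) := by
    refine ProbabilityMeasure.tendsto_of_tendsto_charFun fun x => ?_
    have := h (-x.fst) (-x.snd)
    simp_rw [← charFun_planeMeasure (hg _) (hg0 _), ← charFun_planeMeasure hG hG0] at this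
    exact this
  obtain ⟨C, hC⟩ := hψc.exists_bound_of_continuous hψ
  let Ψ : BoundedContinuousFunction (WithLp 2 (ℝ × ℝ)) ℝ :=
    BoundedContinuousFunction.ofNormedAddCommGroup (fun x => ψ (WithLp.ofLp x)) (by fun_prop) C
      fun x => hC _
  have key := ProbabilityMeasure.tendsto_iff_forall_integral_tendsto.1 hμ Ψ
  have e : ∀ {u : ℝ × ℝ → ℝ}, IntegrableOn u Y → (∀ y ∈ Y, 0 ≤ u y) →
      ∫ x, Ψ x ∂(planeMeasure u) = ∫ y in Y, ψ y * u y := fun hu hu0 => by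
    rw [integral_planeMeasure hu hu0 Ψ.continuous]
    refine integral_congr_ae (ae_of_all _ fun y => ?_)
    simp [Ψ, mul_comm]
  have e1 : ∀ n, ∫ x, Ψ x ∂(μ n : Measure (WithLp 2 (ℝ × ℝ))) = ∫ y in Y, ψ y * g n y :=
    fun n => e (hg n) (hg0 n)
  have e2 : ∫ x, Ψ x ∂(μ₀ : Measure (WithLp 2 (ℝ × ℝ))) = ∫ y in Y, ψ y * G y := e hG hG0
  simpa only [e1, e2] using key

end Levy

/-! ### Mass and transform of the limiting profile -/

section Profile

/-- For fixed m the profile is a Gaussian in p of variance Bm/A; its integral cancels the factor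
1/√m and leaves a pure exponential in m. -/
lemma sqrt_mul_profile_aux {A B m : ℝ} (hA : 0 < A) (hB : 0 < B) (hm : 0 < m) :
    Real.sqrt (Real.pi / (A / (2 * B * m))) / Real.sqrt (2 * Real.pi * A * B) / Real.sqrt m
      = 1 / A := by
  have hp := Real.pi_pos
  rw [show Real.pi / (A / (2 * B * m)) = 2 * Real.pi * A * B * m / A ^ 2 by field_simp,
    Real.sqrt_div (by positivity), Real.sqrt_sq hA.le, Real.sqrt_mul (by positivity)]
  have h1 : Real.sqrt (2 * Real.pi * A * B) ≠ 0 := (Real.sqrt_pos.2 (by positivity)).ne'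
  have h2 : Real.sqrt m ≠ 0 := (Real.sqrt_pos.2 hm).ne'
  field_simp

variable {H A B : ℝ}

/-- The profile as a function of the parameters. -/
noncomputable def profileFun (H A B : ℝ) (y : ℝ × ℝ) : ℝ :=
  4 * H ^ 2 / Real.sqrt (2 * Real.pi * A * B) *
    (Real.exp (-(2 * H ^ 2 * y.1 / A)) * Real.exp (-(A * y.2 ^ 2 / (2 * B * y.1))) /
      Real.sqrt y.1)

lemma profileFun_nonneg (y : ℝ × ℝ) : 0 ≤ profileFun H A B y := by
  unfold profileFun; positivity

lemma measurable_profileFun : Measurable (profileFun H A B) := by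
  unfold profileFun; fun_prop

lemma profileFun_mk (m p : ℝ) : profileFun H A B (m, p) =
    4 * H ^ 2 / Real.sqrt (2 * Real.pi * A * B) * Real.exp (-(2 * H ^ 2 * m / A)) / Real.sqrt m *
      Real.exp (-(A / (2 * B * m)) * p ^ 2) := by
  unfold profileFun
  rw [show -(A / (2 * B * m)) * p ^ 2 = -(A * p ^ 2 / (2 * B * m)) by ring]
  ring

lemma integral_profileFun_snd (hA : 0 < A) (hB : 0 < B) {m : ℝ} (hm : 0 < m) :
    ∫ p, profileFun H A B (m, p) = 4 * H ^ 2 / A * Real.exp (-(2 * H ^ 2 / A) * m) := by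
  simp_rw [profileFun_mk]
  rw [integral_const_mul, integral_gaussian]
  have := sqrt_mul_profile_aux hA hB hm
  calc _ = 4 * H ^ 2 * Real.exp (-(2 * H ^ 2 * m / A)) *
      (Real.sqrt (Real.pi / (A / (2 * B * m))) / Real.sqrt (2 * Real.pi * A * B) / Real.sqrt m) := by
        ring
    _ = _ := by
      rw [this, show -(2 * H ^ 2 / A) * m = -(2 * H ^ 2 * m / A) by ring]; ring

lemma volume_restrict_Y :
    volume.restrict Y = (volume.restrict (Ioi (0 : ℝ))).prod (volume : Measure ℝ) := by
  rw [Y, Measure.volume_eq_prod, ← Measure.prod_restrict, Measure.restrict_univ]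

lemma integrableOn_profileFun (hH : 0 < H) (hA : 0 < A) (hB : 0 < B) :
    IntegrableOn (profileFun H A B) Y := by
  rw [IntegrableOn, volume_restrict_Y,
    integrable_prod_iff measurable_profileFun.aestronglyMeasurable]
  constructor
  · filter_upwards [ae_restrict_mem measurableSet_Ioi] with m hm
    simp_rw [profileFun_mk]
    refine (integrable_exp_neg_mul_sq ?_).const_mul _
    have : 0 < m := hm
    positivity
  · have h := (integrableOn_exp_mul_Ioi (a := -(2 * H ^ 2 / A))
      (by rw [neg_lt_zero]; positivity) 0).const_mul (4 * H ^ 2 / A)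
    refine h.congr ?_
    filter_upwards [ae_restrict_mem measurableSet_Ioi] with m hm
    simp_rw [Real.norm_of_nonneg (profileFun_nonneg _)]
    rw [integral_profileFun_snd hA hB hm]

/-- The value 2 is the limit of the rescaled mass t/(H + t/2): no mass is lost, so half the profile
is the limiting probability density. -/
lemma integral_profileFun (hH : 0 < H) (hA : 0 < A) (hB : 0 < B) :
    ∫ y in Y, profileFun H A B y = 2 := by
  have hi := integrableOn_profileFun hH hA hB
  rw [IntegrableOn, volume_restrict_Y] at hi
  rw [volume_restrict_Y, integral_prod _ hi,
    setIntegral_congr_fun measurableSet_Ioi fun m hm => integral_profileFun_snd hA hB hm,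
    integral_const_mul, integral_exp_mul_Ioi (by rw [neg_lt_zero]; positivity)]
  simp
  field_simp
  norm_num

/-- The Fourier transform of the Gaussian contributes e^{-Bξ²m/(2A)}, again exponential in m, so the
remaining integral is an elementary Laplace integral. -/
lemma integral_chr_profileFun_snd (hA : 0 < A) (hB : 0 < B) (ζ : ℂ) (ξ : ℝ) {m : ℝ} (hm : 0 < m) :
    ∫ p, chr ζ ξ (m, p) * (profileFun H A B (m, p) : ℂ) =
      4 * H ^ 2 / A * Complex.exp (-(2 * H ^ 2 / A + ζ + B * ξ ^ 2 / (2 * A)) * m) := by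
  set b : ℝ := A / (2 * B * m) with hb
  have hb0 : 0 < b := by positivity
  have hA' : (A : ℂ) ≠ 0 := Complex.ofReal_ne_zero.2 hA.ne'
  have hB' : (B : ℂ) ≠ 0 := Complex.ofReal_ne_zero.2 hB.ne'
  have hm' : (m : ℂ) ≠ 0 := Complex.ofReal_ne_zero.2 hm.ne'
  have h1 : ∀ p : ℝ, chr ζ ξ (m, p) * (profileFun H A B (m, p) : ℂ) =
      (Complex.exp (-(m * ζ)) * ((4 * H ^ 2 / Real.sqrt (2 * Real.pi * A * B) *
        Real.exp (-(2 * H ^ 2 * m / A)) / Real.sqrt m : ℝ) : ℂ)) *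
      (Complex.exp (Complex.I * (-ξ : ℂ) * p) * Complex.exp (-(b : ℂ) * p ^ 2)) := fun p => by
    rw [profileFun_mk, chr, Complex.ofReal_mul, Complex.ofReal_exp (-b * p ^ 2)]
    rw [show -(Complex.I * (p : ℂ) * (ξ : ℂ)) = Complex.I * (-ξ : ℂ) * p by ring]
    push_cast
    ring
  simp_rw [h1]
  rw [integral_const_mul, fourierIntegral_gaussian (by simpa using hb0)]
  have h2 : ((Real.pi : ℂ) / (b : ℂ)) ^ (1 / 2 : ℂ) = (Real.sqrt (Real.pi / b) : ℂ) := by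
    rw [Real.sqrt_eq_rpow, Complex.ofReal_cpow (by have := Real.pi_pos; positivity)]
    push_cast
    rfl
  have h3 := sqrt_mul_profile_aux hA hB hm
  rw [← hb] at h3
  rw [h2]
  calc _ = ((4 * H ^ 2 * (Real.sqrt (Real.pi / b) / Real.sqrt (2 * Real.pi * A * B) /
          Real.sqrt m) : ℝ) : ℂ) * (Complex.exp (-(m * ζ)) *
          ((Real.exp (-(2 * H ^ 2 * m / A)) : ℝ) : ℂ) * Complex.exp (-(-(ξ : ℂ)) ^ 2 / (4 * b))) := by
        push_cast; ring
    _ = _ := by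
        rw [h3, Complex.ofReal_exp, ← Complex.exp_add, ← Complex.exp_add]
        congr 1
        · push_cast; ring
        · congr 1
          rw [hb]
          push_cast
          field_simp
          ring

lemma fourierLaplace_profileFun (hH : 0 < H) (hA : 0 < A) (hB : 0 < B) {ζ : ℂ} (hζ : 0 ≤ ζ.re)
    (ξ : ℝ) : fourierLaplace (profileFun H A B) ζ ξ =
      4 * H ^ 2 / (2 * H ^ 2 + A * ζ + B * ξ ^ 2 / 2) := by
  have hi := integrableOn_chr_mul (integrableOn_profileFun hH hA hB) hζ ξ
  rw [IntegrableOn, volume_restrict_Y] at hi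
  have hA' : (A : ℂ) ≠ 0 := Complex.ofReal_ne_zero.2 hA.ne'
  have e : (2 * H ^ 2 / A + ζ + B * ξ ^ 2 / (2 * A) : ℂ).re =
      2 * H ^ 2 / A + ζ.re + B * ξ ^ 2 / (2 * A) := by
    rw [Complex.add_re, Complex.add_re]
    norm_cast
  have hre : 0 < (2 * H ^ 2 / A + ζ + B * ξ ^ 2 / (2 * A) : ℂ).re := by
    rw [e]; positivity
  have hne : (2 * H ^ 2 / A + ζ + B * ξ ^ 2 / (2 * A) : ℂ) ≠ 0 := fun h => by
    rw [h] at hre; simp at hre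
  rw [fourierLaplace_eq, volume_restrict_Y, integral_prod _ hi,
    setIntegral_congr_fun measurableSet_Ioi fun m hm =>
      integral_chr_profileFun_snd hA hB ζ ξ hm,
    integral_const_mul, integral_exp_mul_complex_Ioi (by rw [Complex.neg_re]; linarith)]
  have e2 : (2 * H ^ 2 + A * ζ + B * ξ ^ 2 / 2 : ℂ) =
      A * (2 * H ^ 2 / A + ζ + B * ξ ^ 2 / (2 * A)) := by field_simp
  rw [e2]
  simp only [Complex.ofReal_zero, mul_zero, Complex.exp_zero]
  rw [neg_div_neg_eq, div_mul_div_comm, mul_one]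

end Profile

/-! ### Second-order expansion of the transform at the origin -/

section Expansion

lemma norm_exp_neg_I_mul_sub_one_le (a : ℝ) :
    ‖Complex.exp (-(Complex.I * a)) - 1‖ ≤ |a| := by
  have := Real.norm_exp_I_mul_ofReal_sub_one_le (x := -a)
  simpa using this

lemma norm_exp_neg_I_mul (a : ℝ) : ‖Complex.exp (-(Complex.I * a))‖ = 1 := by
  rw [Complex.norm_exp]; simp

/-- Taylor's bound for |b| ≤ 1; for |b| ≥ 1 the triangle inequality gives 2|b| ≤ 2b². A bound valid
for all b is needed for domination over all p. -/
lemma norm_exp_neg_I_mul_sub_le (b : ℝ) :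
    ‖1 - Complex.exp (-(Complex.I * b)) - Complex.I * b‖ ≤ 2 * b ^ 2 := by
  have hn : ‖-(Complex.I * (b : ℂ))‖ = |b| := by simp
  rcases le_total |b| 1 with h | h
  · have := Complex.norm_exp_sub_one_sub_id_le (x := -(Complex.I * (b : ℂ))) (by rwa [hn])
    rw [hn, sq_abs] at this
    calc _ = ‖Complex.exp (-(Complex.I * b)) - 1 - -(Complex.I * b)‖ := by
          rw [← norm_neg]; congr 1; ring
      _ ≤ b ^ 2 := this
      _ ≤ _ := by nlinarith [sq_nonneg b]
  · calc ‖1 - Complex.exp (-(Complex.I * b)) - Complex.I * b‖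
        ≤ ‖1 - Complex.exp (-(Complex.I * b))‖ + ‖Complex.I * (b : ℂ)‖ := norm_sub_le _ _
      _ ≤ |b| + |b| := by
          gcongr
          · rw [norm_sub_rev]; exact norm_exp_neg_I_mul_sub_one_le b
          · simp
      _ ≤ _ := by rw [← sq_abs]; nlinarith

lemma tendsto_mul_one_sub_exp (c : ℝ) :
    Tendsto (fun t : ℝ => (t : ℂ) * (1 - Complex.exp (-(Complex.I * ((c / t : ℝ) : ℂ))))) atTop
      (𝓝 (Complex.I * c)) := by
  rw [tendsto_iff_norm_sub_tendsto_zero]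
  have hlim : Tendsto (fun t : ℝ => 2 * c ^ 2 * t⁻¹) atTop (𝓝 0) := by
    have h := (tendsto_inv_atTop_zero (𝕜 := ℝ)).const_mul (2 * c ^ 2)
    rwa [mul_zero] at h
  refine squeeze_zero' (Eventually.of_forall fun _ => norm_nonneg _) ?_ hlim
  filter_upwards [eventually_gt_atTop 0] with t ht
  have ht' : (t : ℂ) ≠ 0 := Complex.ofReal_ne_zero.2 ht.ne'
  have e : (t : ℂ) * (1 - Complex.exp (-(Complex.I * ((c / t : ℝ) : ℂ)))) - Complex.I * c =
      t * (1 - Complex.exp (-(Complex.I * ((c / t : ℝ) : ℂ))) -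
        Complex.I * ((c / t : ℝ) : ℂ)) := by
    push_cast; field_simp
  rw [e, norm_mul, Complex.norm_real, Real.norm_of_nonneg ht.le]
  calc _ ≤ t * (2 * (c / t) ^ 2) := by
        gcongr; exact norm_exp_neg_I_mul_sub_le _
    _ = _ := by field_simp

/-- The cubic Taylor remainder at c/√t is of order t^{-3/2}, so it is O(t^{-1/2}) after
multiplication by t. -/
lemma tendsto_mul_one_sub_exp_sub (c : ℝ) :
    Tendsto (fun t : ℝ => (t : ℂ) * (1 - Complex.exp (-(Complex.I * ((c / √t : ℝ) : ℂ)))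
      - Complex.I * ((c / √t : ℝ) : ℂ))) atTop (𝓝 ((c ^ 2 / 2 : ℝ) : ℂ)) := by
  rw [tendsto_iff_norm_sub_tendsto_zero]
  have hlim : Tendsto (fun t : ℝ => |c| ^ 3 * Real.exp |c| * (√t)⁻¹) atTop (𝓝 0) := by
    simpa using (tendsto_inv_atTop_zero.comp Real.tendsto_sqrt_atTop).const_mul
      (|c| ^ 3 * Real.exp |c|)
  refine squeeze_zero' (Eventually.of_forall fun _ => norm_nonneg _) ?_ hlim
  filter_upwards [eventually_ge_atTop 1] with t ht
  have h0 : 0 < t := by linarith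
  have hr : 1 ≤ √t := Real.one_le_sqrt.2 ht
  have hr0 : 0 < √t := by linarith
  have hsq : √t ^ 2 = t := Real.sq_sqrt h0.le
  set x : ℂ := -(Complex.I * ((c / √t : ℝ) : ℂ)) with hx
  have hn : ‖x‖ = |c| / √t := by
    simp only [hx, norm_neg, norm_mul, Complex.norm_I, one_mul, Complex.norm_real,
      Real.norm_eq_abs, abs_div, abs_of_pos hr0]
  have hx2 : x ^ 2 = -((c ^ 2 / t : ℝ) : ℂ) := by
    rw [hx, neg_sq, mul_pow, Complex.I_sq, ← Complex.ofReal_pow, div_pow, hsq]; ring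
  have ht' : (t : ℂ) ≠ 0 := Complex.ofReal_ne_zero.2 h0.ne'
  have e : (t : ℂ) * (1 - Complex.exp x - Complex.I * ((c / √t : ℝ) : ℂ)) -
      ((c ^ 2 / 2 : ℝ) : ℂ) =
      -(t * (Complex.exp x - ∑ m ∈ Finset.range 3, x ^ m / (m.factorial : ℂ))) := by
    rw [show Complex.I * ((c / √t : ℝ) : ℂ) = -x by rw [hx]; ring]
    simp only [Finset.sum_range_succ, Finset.sum_range_zero, hx2]
    simp [Nat.factorial]
    field_simp
    ring
  have hb := Complex.norm_exp_sub_sum_le_norm_mul_exp x 3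
  rw [e, norm_neg, norm_mul, Complex.norm_real, Real.norm_of_nonneg h0.le]
  calc _ ≤ t * (‖x‖ ^ 3 * Real.exp ‖x‖) := by gcongr
    _ ≤ t * ((|c| / √t) ^ 3 * Real.exp |c|) := by
        rw [hn]
        gcongr
        exact div_le_self (abs_nonneg c) hr
    _ = _ := by
        rw [div_pow, pow_succ √t 2, hsq]
        field_simp

variable {fin : ℝ × ℝ → ℝ}

lemma integrableOn_fst_mul (hdecay : IntegrableOn (fun y => weight y * fin y) Y) :
    IntegrableOn (fun y => y.1 * fin y) Y :=
  integrableOn_of_weight hdecay continuous_fst fun y hy => by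
    have := mem_Y.1 hy
    rw [abs_of_pos this, weight]; nlinarith [sq_nonneg y.2]

lemma integrableOn_snd_mul (hdecay : IntegrableOn (fun y => weight y * fin y) Y) :
    IntegrableOn (fun y => y.2 * fin y) Y :=
  integrableOn_of_weight hdecay continuous_snd fun y hy => by
    have := mem_Y.1 hy
    rw [weight, abs_le]
    constructor <;> nlinarith [sq_nonneg (y.2 - 1), sq_nonneg (y.2 + 1)]

lemma integrableOn_snd_sq_mul (hdecay : IntegrableOn (fun y => weight y * fin y) Y) :
    IntegrableOn (fun y => y.2 ^ 2 * fin y) Y :=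
  integrableOn_of_weight hdecay (by fun_prop) fun y hy => by
    have := mem_Y.1 hy
    rw [abs_of_nonneg (sq_nonneg _), weight]; linarith

/-- Reflection in p. This is where evenness enters: a nonzero mean momentum would contribute a term
of order √t to the expansion. -/
lemma integral_snd_mul_eq_zero (heven : ∀ m p : ℝ, 0 < m → fin (m, -p) = fin (m, p)) :
    ∫ y in Y, y.2 * fin y = 0 := by
  rw [← integral_indicator measurableSet_Y]
  let T : (ℝ × ℝ) ≃ᵐ (ℝ × ℝ) := (MeasurableEquiv.refl ℝ).prodCongr (MeasurableEquiv.neg ℝ)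
  have hT : MeasurePreserving T volume volume :=
    (MeasurePreserving.id volume).prod (Measure.measurePreserving_neg volume)
  have h := hT.integral_comp' (Y.indicator fun y => y.2 * fin y)
  have e : ∀ y, Y.indicator (fun y : ℝ × ℝ => y.2 * fin y) (T y) =
      -Y.indicator (fun y : ℝ × ℝ => y.2 * fin y) y := fun y => by
    have hTy : T y = (y.1, -y.2) := rfl
    by_cases hy : y ∈ Y
    · have hy' : (y.1, -y.2) ∈ Y := mem_Y.2 (mem_Y.1 hy)
      rw [hTy, indicator_of_mem hy', indicator_of_mem hy, heven _ _ (mem_Y.1 hy)]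
      ring
    · have hy' : (y.1, -y.2) ∉ Y := fun h => hy (mem_Y.2 (mem_Y.1 h))
      rw [hTy, indicator_of_notMem hy', indicator_of_notMem hy, neg_zero]
  simp_rw [e, integral_neg] at h
  linarith

/-- Second order expansion of the transform of the initial datum in the parabolic scaling. -/
lemma tendsto_mul_fourierLaplace_sub
    (heven : ∀ m p : ℝ, 0 < m → fin (m, -p) = fin (m, p))
    (hdecay : IntegrableOn (fun y => weight y * fin y) Y) (η ξ : ℝ) :
    Tendsto (fun t : ℝ => (t : ℂ) * (fourierLaplace fin 0 0 -
      fourierLaplace fin (Complex.I * η / t) (ξ / √t))) atTop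
      (𝓝 (Complex.I * η * ((∫ y in Y, y.1 * fin y : ℝ) : ℂ) +
        ξ ^ 2 / 2 * ((∫ y in Y, y.2 ^ 2 * fin y : ℝ) : ℂ))) := by
  have hfin := integrableOn_fin hdecay
  have h1 := integrableOn_fst_mul hdecay
  have h2 := integrableOn_snd_mul hdecay
  have h3 := integrableOn_snd_sq_mul hdecay
  have hre : ∀ t : ℝ, 0 ≤ (Complex.I * η / t : ℂ).re := fun t => by
    rw [Complex.div_ofReal_re]; simp
  -- With a = mη/t and b = pξ/√t, `P` is t(1 - e^{-ia}e^{-ib} - ib), split as t(1 - e^{-ia})e^{-ib}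
  -- + t(1 - e^{-ib} - ib). The subtracted ib integrates to zero, and the two pieces are dominated
  -- by |η|m and 2ξ²p², exactly the available moments.
  let P : ℝ → ℝ × ℝ → ℂ := fun t y =>
    (t : ℂ) * (1 - Complex.exp (-(Complex.I * ((y.1 * η / t : ℝ) : ℂ)))) *
      Complex.exp (-(Complex.I * ((y.2 * ξ / √t : ℝ) : ℂ))) +
    (t : ℂ) * (1 - Complex.exp (-(Complex.I * ((y.2 * ξ / √t : ℝ) : ℂ)))
      - Complex.I * ((y.2 * ξ / √t : ℝ) : ℂ))
  have key : Tendsto (fun t : ℝ => ∫ y in Y, P t y * (fin y : ℂ)) atTop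
      (𝓝 (∫ y in Y, (Complex.I * ((y.1 * η : ℝ) : ℂ) + (((y.2 * ξ) ^ 2 / 2 : ℝ) : ℂ)) *
        (fin y : ℂ))) := by
    refine tendsto_integral_filter_of_dominated_convergence
      (fun y => |η| * ‖y.1 * fin y‖ + 2 * ξ ^ 2 * ‖y.2 ^ 2 * fin y‖) ?_ ?_ ?_ ?_
    · refine Eventually.of_forall fun t => ?_
      refine AEStronglyMeasurable.mul (Continuous.aestronglyMeasurable ?_)
        hfin.ofReal.aestronglyMeasurable
      fun_prop
    · filter_upwards [eventually_gt_atTop 0] with t ht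
      refine ae_of_all _ fun y => ?_
      have hsq : √t ^ 2 = t := Real.sq_sqrt ht.le
      have hP : ‖P t y‖ ≤ |η| * |y.1| + 2 * ξ ^ 2 * y.2 ^ 2 := by
        refine (norm_add_le _ _).trans ?_
        rw [norm_mul, norm_mul, norm_mul, norm_exp_neg_I_mul, mul_one, Complex.norm_real,
          Real.norm_of_nonneg ht.le]
        have a1 : ‖1 - Complex.exp (-(Complex.I * ((y.1 * η / t : ℝ) : ℂ)))‖ ≤ |y.1 * η / t| := by
          rw [norm_sub_rev]; exact norm_exp_neg_I_mul_sub_one_le _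
        have a2 := norm_exp_neg_I_mul_sub_le (y.2 * ξ / √t)
        calc _ ≤ t * |y.1 * η / t| + t * (2 * (y.2 * ξ / √t) ^ 2) := by gcongr
          _ = _ := by
            rw [abs_div, abs_mul, abs_of_pos ht, div_pow, hsq]
            field_simp
      rw [norm_mul, Complex.norm_real, norm_mul, norm_mul, Real.norm_eq_abs y.1,
        Real.norm_of_nonneg (sq_nonneg y.2)]
      calc _ ≤ (|η| * |y.1| + 2 * ξ ^ 2 * y.2 ^ 2) * ‖fin y‖ := by gcongr
        _ = _ := by ring
    · exact (h1.norm.const_mul _).add (h3.norm.const_mul _)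
    · refine ae_of_all _ fun y => ?_
      refine Tendsto.mul_const _ (Tendsto.add ?_ (tendsto_mul_one_sub_exp_sub _))
      have hexp : Tendsto (fun t : ℝ => Complex.exp (-(Complex.I * ((y.2 * ξ / √t : ℝ) : ℂ))))
          atTop (𝓝 1) := by
        have h0 : Tendsto (fun t : ℝ => y.2 * ξ / √t) atTop (𝓝 0) :=
          Real.tendsto_sqrt_atTop.const_div_atTop _
        have hc : Continuous fun x : ℝ => Complex.exp (-(Complex.I * (x : ℂ))) := by fun_prop
        have := (hc.tendsto 0).comp h0
        simp only [Complex.ofReal_zero, mul_zero, neg_zero, Complex.exp_zero] at this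
        exact this
      simpa using (tendsto_mul_one_sub_exp (y.1 * η)).mul hexp
  have elim : ∫ y in Y, (Complex.I * ((y.1 * η : ℝ) : ℂ) + (((y.2 * ξ) ^ 2 / 2 : ℝ) : ℂ)) *
        (fin y : ℂ) = Complex.I * η * ((∫ y in Y, y.1 * fin y : ℝ) : ℂ) +
        ξ ^ 2 / 2 * ((∫ y in Y, y.2 ^ 2 * fin y : ℝ) : ℂ) := by
    rw [← integral_complex_ofReal, ← integral_complex_ofReal, ← integral_const_mul,
      ← integral_const_mul, ← integral_add]
    · refine integral_congr_ae (ae_of_all _ fun y => ?_)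
      push_cast; ring
    · exact h1.ofReal.const_mul _
    · exact h3.ofReal.const_mul _
  rw [elim] at key
  refine key.congr fun t => ?_
  have hI := integrableOn_chr_mul hfin (ζ := 0) le_rfl 0
  have hJ := integrableOn_chr_mul hfin (hre t) (ξ / √t)
  have hK : Integrable (fun y => (Complex.I * ((ξ / √t : ℝ) : ℂ)) * ((y.2 * fin y : ℝ) : ℂ))
      (volume.restrict Y) := h2.ofReal.const_mul _
  have hz : ∫ y in Y, (Complex.I * ((ξ / √t : ℝ) : ℂ)) * ((y.2 * fin y : ℝ) : ℂ) = 0 := by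
    rw [integral_const_mul, integral_complex_ofReal, integral_snd_mul_eq_zero heven]; simp
  have hs : ∫ y in Y, (chr 0 0 y * (fin y : ℂ) - chr (Complex.I * η / t) (ξ / √t) y * (fin y : ℂ)
      - (Complex.I * ((ξ / √t : ℝ) : ℂ)) * ((y.2 * fin y : ℝ) : ℂ)) =
      fourierLaplace fin 0 0 - fourierLaplace fin (Complex.I * η / t) (ξ / √t) := by
    rw [integral_sub (by exact hI.sub hJ) hK, hz, sub_zero, integral_sub hI hJ]
    rfl
  rw [← hs, ← integral_const_mul]
  refine integral_congr_ae (ae_of_all _ fun y => ?_)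
  have e1 : chr (Complex.I * η / t) (ξ / √t) y =
      Complex.exp (-(Complex.I * ((y.1 * η / t : ℝ) : ℂ))) *
        Complex.exp (-(Complex.I * ((y.2 * ξ / √t : ℝ) : ℂ))) := by
    unfold chr
    congr 2 <;> (push_cast; ring)
  simp only [P, e1, chr_zero_zero]
  push_cast
  ring

end Expansion

/-! ### Self-similar long-time behaviour -/

section LongTime

variable {fin : ℝ × ℝ → ℝ}

lemma integral_mul_pos (hnonneg : ∀ y ∈ Y, 0 ≤ fin y) (hpos : 0 < moment 0 0 fin)
    {u : ℝ × ℝ → ℝ} (hu : IntegrableOn (fun y => u y * fin y) Y)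
    (hu0 : ∀ᵐ y ∂(volume.restrict Y), 0 < u y) : 0 < ∫ y in Y, u y * fin y := by
  have h0 : 0 ≤ᵐ[volume.restrict Y] fun y => u y * fin y := by
    filter_upwards [hu0, ae_restrict_mem measurableSet_Y] with y hy hyY
    exact mul_nonneg hy.le (hnonneg y hyY)
  refine lt_of_le_of_ne (integral_nonneg_of_ae h0) fun h => ?_
  have h1 := (integral_eq_zero_iff_of_nonneg_ae h0 hu).1 h.symm
  have h2 : ∫ y in Y, fin y = 0 := by
    rw [← integral_zero (ℝ × ℝ) ℝ (μ := volume.restrict Y)]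
    refine integral_congr_ae ?_
    filter_upwards [h1, hu0] with y hy hy0
    exact (mul_eq_zero.1 hy).resolve_left hy0.ne'
  rw [moment_zero_zero, h2] at hpos
  exact lt_irrefl _ hpos

lemma ae_snd_ne_zero : ∀ᵐ z : ℝ × ℝ, z.2 ≠ 0 := by
  have : {z : ℝ × ℝ | ¬ z.2 ≠ 0} = univ ×ˢ {0} := by ext; simp
  rw [ae_iff, this, Measure.volume_eq_prod, Measure.prod_prod]
  simp

lemma calA_pos (hnonneg : ∀ y ∈ Y, 0 ≤ fin y)
    (hdecay : IntegrableOn (fun y => weight y * fin y) Y) (hpos : 0 < moment 0 0 fin) :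
    0 < calA fin := by
  have := H₀_pos hpos
  refine mul_pos (by positivity) (integral_mul_pos hnonneg hpos (integrableOn_fst_mul hdecay) ?_)
  filter_upwards [ae_restrict_mem measurableSet_Y] with y hy using mem_Y.1 hy

/-- p² vanishes only on a null line, which a density does not charge. -/
lemma calB_pos (hnonneg : ∀ y ∈ Y, 0 ≤ fin y)
    (hdecay : IntegrableOn (fun y => weight y * fin y) Y) (hpos : 0 < moment 0 0 fin) :
    0 < calB fin := by
  have := H₀_pos hpos
  refine mul_pos (by positivity)
    (integral_mul_pos hnonneg hpos (integrableOn_snd_sq_mul hdecay) ?_)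
  filter_upwards [ae_restrict_of_ae ae_snd_ne_zero] with y hy
  positivity

lemma profile_eq_profileFun : profile fin = profileFun (H₀ fin) (calA fin) (calB fin) := rfl

/-- The limit of the explicit transform in the parabolic scaling. -/
lemma tendsto_mul_explicitF (hnonneg : ∀ y ∈ Y, 0 ≤ fin y)
    (heven : ∀ m p : ℝ, 0 < m → fin (m, -p) = fin (m, p))
    (hdecay : IntegrableOn (fun y => weight y * fin y) Y) (hpos : 0 < moment 0 0 fin) (η ξ : ℝ) :
    Tendsto (fun t : ℝ => ((H₀ fin + t / 2 : ℝ) : ℂ) *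
      explicitF fin t (Complex.I * η / t) (ξ / √t)) atTop
      (𝓝 (fourierLaplace (fun y => 1 / 2 * profile fin y) (Complex.I * η) ξ)) := by
  have hH := H₀_pos hpos
  have hA := calA_pos hnonneg hdecay hpos
  have hB := calB_pos hnonneg hdecay hpos
  have hH' : (H₀ fin : ℂ) ≠ 0 := Complex.ofReal_ne_zero.2 hH.ne'
  have hre : ∀ t : ℝ, 0 ≤ (Complex.I * η / t : ℂ).re := fun t => by
    rw [Complex.div_ofReal_re]; simp
  have hexp := tendsto_mul_fourierLaplace_sub heven hdecay η ξ
  rw [fourierLaplace_const_mul, profile_eq_profileFun, fourierLaplace_profileFun hH hA hB (by simp)]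
  have hMA : ((∫ y in Y, y.1 * fin y : ℝ) : ℂ) = calA fin / (H₀ fin : ℂ) ^ 2 := by
    unfold calA; push_cast; field_simp
  have hMB : ((∫ y in Y, y.2 ^ 2 * fin y : ℝ) : ℂ) = calB fin / (H₀ fin : ℂ) ^ 2 := by
    unfold calB; push_cast; field_simp
  rw [hMA, hMB, fourierLaplace_zero_zero] at hexp
  set H := H₀ fin
  set A := calA fin
  set B := calB fin
  set φ : ℝ → ℂ := fun t => (H : ℂ) * fourierLaplace fin (Complex.I * η / t) (ξ / √t) with hφ
  set ℓ : ℂ := Complex.I * η * (A / (H : ℂ) ^ 2) + ξ ^ 2 / 2 * (B / (H : ℂ) ^ 2) with hℓ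
  have h1 : Tendsto (fun t : ℝ => (t : ℂ) * (1 - φ t)) atTop (𝓝 (H * ℓ)) := by
    refine (hexp.const_mul (H : ℂ)).congr fun t => ?_
    simp only [hφ]
    push_cast
    field_simp
  have h2 : Tendsto φ atTop (𝓝 1) := by
    have hinv : Tendsto (fun t : ℝ => ((t⁻¹ : ℝ) : ℂ)) atTop (𝓝 0) := by
      have := (Complex.continuous_ofReal.tendsto 0).comp tendsto_inv_atTop_zero
      rw [Complex.ofReal_zero] at this
      exact this
    have h3 := (hinv.mul h1).const_sub 1
    rw [zero_mul, sub_zero] at h3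
    refine h3.congr' ?_
    filter_upwards [eventually_gt_atTop 0] with t ht
    have ht' : (t : ℂ) ≠ 0 := Complex.ofReal_ne_zero.2 ht.ne'
    push_cast
    field_simp
    ring
  -- The limit of the denominator has positive real part: the η term is purely imaginary and the ξ
  -- term is nonnegative.
  have hne : (H : ℂ) + 1 / 2 * (H * ℓ) ≠ 0 := by
    have hr : ((H : ℂ) + 1 / 2 * (H * ℓ)).re = H + ξ ^ 2 * B / (4 * H) := by
      have : (H : ℂ) + 1 / 2 * (H * ℓ) = ((H + ξ ^ 2 * B / (4 * H) : ℝ) : ℂ) +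
          ((η * A / (2 * H) : ℝ) : ℂ) * Complex.I := by
        rw [hℓ]; push_cast; field_simp; ring
      rw [this, Complex.add_re, Complex.re_ofReal_mul, Complex.ofReal_re, Complex.I_re, mul_zero,
        add_zero]
    intro h0
    rw [h0] at hr
    have : 0 < H + ξ ^ 2 * B / (4 * H) := by positivity
    simp at hr
    linarith
  -- One factor H + t/2 cancels in `explicitF_eq`, and the other denominator factor is H + t/2 - φ
  -- t/2 = H + ½ t(1 - φ), whose limit is known.
  have h4 := (h2.const_mul (H : ℂ)).div ((h1.const_mul (1 / 2 : ℂ)).const_add (H : ℂ)) hne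
  have elim : (H : ℂ) * 1 / (H + 1 / 2 * (H * ℓ)) =
      ((1 / 2 : ℝ) : ℂ) * (4 * H ^ 2 / (2 * H ^ 2 + A * (Complex.I * η) + B * ξ ^ 2 / 2)) := by
    have e : (2 * H ^ 2 + A * (Complex.I * η) + B * ξ ^ 2 / 2 : ℂ) =
        2 * H * (H + 1 / 2 * (H * ℓ)) := by
      rw [hℓ]; field_simp; ring
    rw [e]
    push_cast
    field_simp
    norm_num
  rw [← elim]
  refine h4.congr' ?_
  filter_upwards [eventually_ge_atTop 0] with t ht
  have hs := add_half_ne_zero hH ht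
  rw [explicitF_eq hnonneg hdecay hpos ht (hre t)]
  simp only [Pi.div_apply]
  change _ = _ * ((H : ℂ) * φ t / (((H : ℂ) + t / 2) * ((H : ℂ) + t / 2 - φ t * (t / 2))))
  rw [← mul_div_assoc, Complex.ofReal_add, Complex.ofReal_div, Complex.ofReal_ofNat,
    mul_div_mul_left _ _ hs]
  congr 1
  ring

variable {q : ℝ × ℝ → ℝ≥0∞} {H t : ℝ}

/-- The dilation has Jacobian t · √t; the remaining factor t compensates the decay of the total
mass, which is asymptotic to 2/t. -/
lemma rpow_five_half_mul (ht : 0 < t) : t ^ (5 / 2 : ℝ) * (t * √t)⁻¹ = t := by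
  have : t ^ (5 / 2 : ℝ) = t * (t * √t) := by
    rw [Real.sqrt_eq_rpow, show (5 / 2 : ℝ) = 1 + (1 + 1 / 2) by norm_num,
      Real.rpow_add ht, Real.rpow_add ht, Real.rpow_one]
  have h0 : 0 < √t := Real.sqrt_pos.2 ht
  rw [this]
  field_simp

lemma integrable_rescaled (hq : IsDensity q) (hH : 0 < H) (ht : 0 < t) :
    Integrable (rescaled (sol q H) t) :=
  (integrable_comp_dilation ht.ne' (Real.sqrt_pos.2 ht).ne'
    (integrable_sol hq hH ht.le)).const_mul _

lemma integral_rescaled (hq : IsDensity q) (hH : 0 < H) (ht : 0 < t) :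
    ∫ y in Y, rescaled (sol q H) t y = t / (H + t / 2) := by
  simp only [rescaled]
  rw [integral_const_mul, integral_comp_dilation ht (Real.sqrt_pos.2 ht) (sol q H t),
    setIntegral_Y_sol hq hH ht.le, smul_eq_mul, ← mul_assoc, rpow_five_half_mul ht]
  ring

lemma fourierLaplace_rescaled (ht : 0 < t) (ζ : ℂ) (ξ : ℝ) :
    fourierLaplace (rescaled (sol q H) t) ζ ξ =
      t * fourierLaplace (sol q H t) (ζ / t) (ξ / √t) := by
  have : rescaled (sol q H) t = fun y => t ^ (5 / 2 : ℝ) * sol q H t (t * y.1, √t * y.2) := rfl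
  rw [this, fourierLaplace_const_mul,
    fourierLaplace_comp_dilation ht (Real.sqrt_pos.2 ht) (sol q H t), ← mul_assoc,
    ← Complex.ofReal_mul, rpow_five_half_mul ht]

/-- Multiplying by (H₀ + t/2)/t makes the rescaled solution a probability density. Lévy's theorem
along arbitrary sequences of times gives convergence to half the profile, and the factor t/(H₀ +
t/2) → 2 is then restored. -/
lemma weaklyConverges_sol (hnonneg : ∀ y ∈ Y, 0 ≤ fin y)
    (heven : ∀ m p : ℝ, 0 < m → fin (m, -p) = fin (m, p))
    (hdecay : IntegrableOn (fun y => weight y * fin y) Y) (hpos : 0 < moment 0 0 fin) :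
    WeaklyConverges (rescaled (sol (initialDensity fin) (H₀ fin))) (profile fin) := by
  have hH := H₀_pos hpos
  have hA := calA_pos hnonneg hdecay hpos
  have hB := calB_pos hnonneg hdecay hpos
  have hq := isDensity_initialDensity hnonneg hdecay hpos
  have hprof : IntegrableOn (profile fin) Y := integrableOn_profileFun hH hA hB
  refine ⟨?_, hprof, fun ψ hψ hψc _ => ?_⟩
  · filter_upwards [eventually_gt_atTop 0] with t ht
    exact (integrable_rescaled hq hH ht).integrableOn
  set f := sol (initialDensity fin) (H₀ fin) with hf
  refine tendsto_of_seq_tendsto fun u hu => ?_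
  -- times are bounded below by `1` to get genuine probability densities for every index
  set v : ℕ → ℝ := fun n => max (u n) 1 with hv
  have hv0 : ∀ n, 0 < v n := fun n => lt_of_lt_of_le one_pos (le_max_right _ _)
  have huv : ∀ᶠ n in atTop, v n = u n := by
    filter_upwards [hu.eventually_ge_atTop 1] with n hn using max_eq_left hn
  have hvlim : Tendsto v atTop atTop := hu.congr' (huv.mono fun _ h => h.symm)
  have hc : Tendsto (fun t : ℝ => t / (H₀ fin + t / 2)) atTop (𝓝 2) := by
    have h1 : Tendsto (fun t : ℝ => (H₀ fin * t⁻¹ + 1 / 2)⁻¹) atTop (𝓝 2) := by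
      have := ((tendsto_inv_atTop_zero.const_mul (H₀ fin)).add_const (1 / 2)).inv₀
        (by norm_num)
      simpa using this
    refine h1.congr' ?_
    filter_upwards [eventually_gt_atTop 0] with t ht
    field_simp
  have key := tendsto_integral_of_tendsto_fourierLaplace
    (g := fun n y => (H₀ fin + v n / 2) / v n * rescaled f (v n) y)
    (G := fun y => 1 / 2 * profile fin y)
    (fun n => ((integrable_rescaled hq hH (hv0 n)).const_mul _).integrableOn)
    (fun n y _ => ?_) (fun n => ?_) (hprof.const_mul _) (fun y _ => ?_) ?_ (fun η ξ => ?_) hψ hψc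
  · have h2 := (hc.comp hvlim).mul key
    have e0 : 2 * ∫ y in Y, ψ y * (1 / 2 * profile fin y) = ∫ y in Y, ψ y * profile fin y := by
      rw [← integral_const_mul]
      refine integral_congr_ae (ae_of_all _ fun y => ?_)
      beta_reduce; ring
    rw [e0] at h2
    refine h2.congr' ?_
    filter_upwards [huv] with n hn
    have := hv0 n
    simp only [Function.comp_apply]
    rw [← hn, ← integral_const_mul]
    refine integral_congr_ae (ae_of_all _ fun y => ?_)
    beta_reduce
    field_simp
  · have := hv0 n
    have h1 : 0 ≤ rescaled f (v n) y := mul_nonneg (by positivity) (sol_nonneg hH)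
    positivity
  · have := hv0 n
    rw [integral_const_mul, integral_rescaled hq hH this]
    field_simp
  · exact mul_nonneg (by norm_num) (profileFun_nonneg y)
  · rw [integral_const_mul, profile_eq_profileFun, integral_profileFun hH hA hB]; norm_num
  · refine ((tendsto_mul_explicitF hnonneg heven hdecay hpos η ξ).comp hvlim).congr fun n => ?_
    have hv' : (v n : ℂ) ≠ 0 := Complex.ofReal_ne_zero.2 (hv0 n).ne'
    have hre : 0 ≤ (Complex.I * η / (v n) : ℂ).re := by
      rw [Complex.div_ofReal_re]; simp
    rw [Function.comp_apply, fourierLaplace_const_mul, fourierLaplace_rescaled (hv0 n),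
      fourierLaplace_sol hnonneg hdecay hpos (hv0 n).le hre]
    push_cast
    field_simp

end LongTime

end Coag

theorem mainTheorem2 (fin : ℝ × ℝ → ℝ)
    (hnonneg : ∀ y ∈ Coag.Y, 0 ≤ fin y)
    (heven : ∀ m p : ℝ, 0 < m → fin (m, -p) = fin (m, p))
    (hdecay : IntegrableOn (fun y => Coag.weight y * fin y) Coag.Y)
    (hpos : 0 < Coag.moment 0 0 fin) :
    -- the explicit formula is well defined and solves the Bernoulli equation
    (∀ t : ℝ, 0 ≤ t → ∀ ζ : ℂ, 0 ≤ ζ.re → ∀ ξ : ℝ,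
      (Coag.fourierLaplace fin ζ ξ ≠ 0 → Coag.denomFactor fin t ζ ξ ≠ 0) ∧
      Coag.explicitF fin 0 ζ ξ = Coag.fourierLaplace fin ζ ξ ∧
      Coag.explicitF fin t 0 0 = ((1 / (Coag.H₀ fin + t / 2) : ℝ) : ℂ) ∧
      HasDerivWithinAt (fun s : ℝ => Coag.explicitF fin s ζ ξ)
        ((1 / 2 : ℂ) * Coag.explicitF fin t ζ ξ ^ 2
          - Coag.explicitF fin t 0 0 * Coag.explicitF fin t ζ ξ) (Ici 0) t) ∧
    -- its inverse transform is a solution, with self-similar long-time behaviour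
    ∃ f : ℝ → ℝ × ℝ → ℝ,
      Coag.IsSolution (fun _ _ => 1) fin f ∧
      (∀ t : ℝ, 0 ≤ t → Coag.IsInverseFourierLaplace (Coag.explicitF fin t) (f t)) ∧
      Coag.WeaklyConverges (Coag.rescaled f) (Coag.profile fin) ∧
      -- for continuous bounded data the solution is a classical one
      (ContinuousOn fin Coag.Y → (∃ C : ℝ, ∀ y ∈ Coag.Y, fin y ≤ C) →
        ∀ t : ℝ, 0 ≤ t →
          ContinuousOn (f t) Coag.Y ∧ ∀ y ∈ Coag.Y, Coag.SolvesAt (fun _ _ => 1) f t y) := by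
  have hH := Coag.H₀_pos hpos
  refine ⟨fun t ht ζ hζ ξ => ⟨fun hF => Coag.denomFactor_ne_zero hnonneg hdecay hpos ht hζ hF,
    Coag.explicitF_zero_time hnonneg hdecay hpos hζ ξ,
    Coag.explicitF_zero_zero hnonneg hdecay hpos ht,
    Coag.hasDerivWithinAt_explicitF hnonneg hdecay hpos ht hζ ξ⟩,
    Coag.sol (Coag.initialDensity fin) (Coag.H₀ fin), ?_, ?_, ?_, ?_⟩
  · refine Coag.isSolution_sol (Coag.isDensity_initialDensity hnonneg hdecay hpos) hH
      fun y hy => ?_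
    rw [Coag.initialDensity_toReal hnonneg hpos hy, mul_div_cancel_left₀ _ hH.ne']
  · exact fun t ht => Coag.isInverseFourierLaplace_sol hnonneg hdecay hpos ht
  · exact Coag.weaklyConverges_sol hnonneg heven hdecay hpos
  · rintro hc ⟨C, hC⟩ t ht
    have h := Coag.classical_sol hnonneg hdecay hpos hc hC ht
    exact ⟨h.1, fun y _ => h.2 y⟩
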